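/- **Theorem.** An election consists of a nonempty finite set $C$ of candidates, a nonempty finite set $V$ of voters, and a profile $\mathcal P=(\succ_i)_{i\in V}$ of strict total orders (votes) on $C$. A vote $\succ$ with top-ranked candidate $c$ is single-peaked with respect to an axis (a strict total order $>$ on the candidates) if, for all candidates $x,y$, each of $x>y>c$ and $c>y>x$ implies $c\succ y\succ x$. A profile is single-peaked consistent if all its votes are single-peaked with respect to one common axis. For $C'\subseteq C$, $\mathcal P[C']$ denotes the restriction of all votes to $C'$. The profile $\mathcal P$ is $k$-candidate deletion single-peaked consistent if $\mathcal P[C\setminus D]$ is single-peaked consistent for some $D\subseteq C$ with $|D|\le k$. The problem *Candidate Deletion Single-Peaked Consistency* (given an election $(C,V,\mathcal P)$ and an integer $k$, decide whether $\mathcal P$ is $k$-candidate deletion single-peaked consistent) can be solved in time $\mathcal O(|V|\cdot|C|^5)$; within the same time bound one can also find a set $C'\subseteq C$ of maximum cardinality such that $\mathcal P[C']$ is single-peaked consistent. Precisely: there are one program (for a unit-cost random access machine with registers, arrays, structured control flow, the operations $+$, truncated $-$, $\cdot$, $<$, $=$, and zero-initialised memory) and one constant $K$ such that, for all $n,m\ge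 1$, all $k\ge 0$ and all profiles of $n$ votes over $m$ candidates, given $n$, $m$, $k$ and the votes as lists of candidates from best to worst, the program halts after at most $K\cdot n\cdot m^5$ elementary steps, never computes a number $\ge (n+m+k+2)^K$ (i.e. works with words of $O(\log(n+m+k))$ bits), outputs $1$ if $\mathcal P$ is $k$-candidate deletion single-peaked consistent and $0$ otherwise, and outputs a maximum-cardinality set $C'$ as above. -/

import Mathlib

namespace NearlySinglePeaked

/-! Elections and single-peakedness -/

/-- A (strict, tie-free) total order on `C`. For a vote, `rel a b` reads `a ≻ b`
(`a` is preferred to `b`); for an axis, `rel a b` reads `a > b`. -/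
structure TotalOrder (C : Type*) where
  rel : C → C → Prop
  isStrictTotalOrder : IsStrictTotalOrder C rel

namespace TotalOrder

variable {C : Type*}

/-- The restriction of a total order to the candidates in `S`. -/
def restrict (r : TotalOrder C) (S : Set C) : TotalOrder S where
  rel a b := r.rel a.1 b.1
  isStrictTotalOrder :=
    haveI := r.isStrictTotalOrder
    (Subrel.relEmbedding r.rel (· ∈ S)).isStrictTotalOrder

/-- `c` is the peak of the vote: it is preferred to every other candidate. -/
def IsPeak (vote : TotalOrder C) (c : C) : Prop :=
  ∀ c', c' ≠ c → vote.rel c c'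

/-- The vote is single-peaked with respect to the axis: with `c` the peak of the vote,
`x > y > c` or `c > y > x` on the axis implies `c ≻ y ≻ x`. -/
def SinglePeakedWrt (vote axis : TotalOrder C) : Prop :=
  ∀ c, vote.IsPeak c → ∀ x y,
    (axis.rel x y ∧ axis.rel y c) ∨ (axis.rel c y ∧ axis.rel y x) →
      vote.rel c y ∧ vote.rel y x

/-- The total order `p 0 ≻ p 1 ≻ ... ≻ p (m - 1)` given by a list of all the candidates. -/
def ofList {m : ℕ} (p : Equiv.Perm (Fin m)) : TotalOrder (Fin m) where
  rel a b := p.symm a < p.symm b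
  isStrictTotalOrder :=
    (RelEmbedding.preimage p.symm.toEmbedding (· < ·)).isStrictTotalOrder

end TotalOrder

/-- A preference profile: one vote for every voter. -/
def Profile (V C : Type*) := V → TotalOrder C

namespace Profile

variable {V C : Type*}

/-- The profile restricted to the candidates in `S`. -/
def restrict (P : Profile V C) (S : Set C) : Profile V S :=
  fun i => (P i).restrict S

/-- Some axis makes all the votes single-peaked. -/
def SinglePeakedConsistent (P : Profile V C) : Prop :=
  ∃ axis : TotalOrder C, ∀ i, (P i).SinglePeakedWrt axis

/-- Removing a set `D` of at most `k` candidates makes the profile single-peaked consistent. -/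
def CandidateDeletionConsistent (P : Profile V C) (k : ℕ) : Prop :=
  ∃ D : Finset C, D.card ≤ k ∧ (P.restrict {c | c ∉ D}).SinglePeakedConsistent

/-- `S` is a maximum-cardinality set of candidates on which the profile is single-peaked
consistent. -/
def IsMaximumSinglePeakedSubset (P : Profile V C) (S : Finset C) : Prop :=
  (P.restrict {c | c ∈ S}).SinglePeakedConsistent ∧
    ∀ T : Finset C, (P.restrict {c | c ∈ T}).SinglePeakedConsistent → T.card ≤ S.card

end Profile

/-! A random access machine on words, programmed with structured control flow -/

/-- The store: scalar registers and random access arrays (all indexed by natural numbers; a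
program mentions only finitely many registers and finitely many arrays). -/
structure Store where
  reg : ℕ → ℕ
  arr : ℕ → ℕ → ℕ

/-- Write a register. -/
def Store.setReg (s : Store) (x v : ℕ) : Store :=
  { s with reg := Function.update s.reg x v }

/-- Write cell `i` of array `a`. -/
def Store.setArr (s : Store) (a i v : ℕ) : Store :=
  { s with arr := Function.update s.arr a (Function.update (s.arr a) i v) }

/-- Expressions. -/
inductive Expr where
  | const (v : ℕ)
  | reg (x : ℕ)
  | load (a : ℕ) (i : Expr)
  | add (e f : Expr)
  | sub (e f : Expr)
  | mul (e f : Expr)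
  | lt (e f : Expr)
  | eq (e f : Expr)

namespace Expr

/-- The value of an expression; subtraction is truncated at `0` and comparisons return
`1` (true) or `0` (false). -/
def eval (s : Store) : Expr → ℕ
  | const v => v
  | reg x => s.reg x
  | load a i => s.arr a (i.eval s)
  | add e f => e.eval s + f.eval s
  | sub e f => e.eval s - f.eval s
  | mul e f => e.eval s * f.eval s
  | lt e f => if e.eval s < f.eval s then 1 else 0
  | eq e f => if e.eval s = f.eval s then 1 else 0

/-- No overflow: the expression and all its subexpressions (in particular all the addresses)
have values below the word bound `W`. -/
def Fits (W : ℕ) (s : Store) : Expr → Prop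
  | const v => v < W
  | reg x => s.reg x < W
  | load a i => i.Fits W s ∧ s.arr a (i.eval s) < W
  | add e f => e.Fits W s ∧ f.Fits W s ∧ e.eval s + f.eval s < W
  | sub e f => e.Fits W s ∧ f.Fits W s
  | mul e f => e.Fits W s ∧ f.Fits W s ∧ e.eval s * f.eval s < W
  | lt e f => e.Fits W s ∧ f.Fits W s ∧ 1 < W
  | eq e f => e.Fits W s ∧ f.Fits W s ∧ 1 < W

/-- The number of elementary operations needed to evaluate an expression: every constant,
register access, array access and arithmetic operation or comparison counts as one. -/
def cost : Expr → ℕ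
  | const _ => 1
  | reg _ => 1
  | load _ i => i.cost + 1
  | add e f => e.cost + f.cost + 1
  | sub e f => e.cost + f.cost + 1
  | mul e f => e.cost + f.cost + 1
  | lt e f => e.cost + f.cost + 1
  | eq e f => e.cost + f.cost + 1

end Expr

/-- Programs. -/
inductive Program where
  | skip
  | assign (x : ℕ) (e : Expr)
  | store (a : ℕ) (i e : Expr)
  | seq (p q : Program)
  | ite (b : Expr) (p q : Program)
  | while (b : Expr) (p : Program)

/-- `Exec W p s t s'`: with word bound `W`, the program `p` started in the store `s` halts, after
exactly `t` elementary steps, in the store `s'`, without ever producing a value `≥ W`. A condition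
is true when its value is not `0`. -/
inductive Exec (W : ℕ) : Program → Store → ℕ → Store → Prop where
  | skip (s : Store) : Exec W .skip s 1 s
  | assign (s : Store) (x : ℕ) (e : Expr) (he : e.Fits W s) :
      Exec W (.assign x e) s (e.cost + 1) (s.setReg x (e.eval s))
  | store (s : Store) (a : ℕ) (i e : Expr) (hi : i.Fits W s) (he : e.Fits W s) :
      Exec W (.store a i e) s (i.cost + e.cost + 1) (s.setArr a (i.eval s) (e.eval s))
  | seq {p q : Program} {s s' s'' : Store} {t t' : ℕ}
      (hp : Exec W p s t s') (hq : Exec W q s' t' s'') :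
      Exec W (.seq p q) s (t + t') s''
  | ite_true {b : Expr} {p : Program} (q : Program) {s s' : Store} {t : ℕ}
      (hb : b.Fits W s) (hv : b.eval s ≠ 0) (hp : Exec W p s t s') :
      Exec W (.ite b p q) s (b.cost + 1 + t) s'
  | ite_false {b : Expr} (p : Program) {q : Program} {s s' : Store} {t : ℕ}
      (hb : b.Fits W s) (hv : b.eval s = 0) (hq : Exec W q s t s') :
      Exec W (.ite b p q) s (b.cost + 1 + t) s'
  | while_true {b : Expr} {p : Program} {s s' s'' : Store} {t t' : ℕ}
      (hb : b.Fits W s) (hv : b.eval s ≠ 0) (hp : Exec W p s t s')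
      (hw : Exec W (.while b p) s' t' s'') :
      Exec W (.while b p) s (b.cost + 1 + t + t') s''
  | while_false {b : Expr} (p : Program) {s : Store} (hb : b.Fits W s) (hv : b.eval s = 0) :
      Exec W (.while b p) s (b.cost + 1) s

/-! Inputs -/

/-- The profile of the voters `0, ..., n - 1` over the candidates `0, ..., m - 1` in which
voter `i` ranks `votes i j` at position `j` (position `0` being the best). -/
def profileOf {n m : ℕ} (votes : Fin n → Equiv.Perm (Fin m)) : Profile (Fin n) (Fin m) :=
  fun i => TotalOrder.ofList (votes i)

/-- The initial store. Registers `0`, `1`, `2` contain `n`, `m`, `k`; array `0` contains the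
`n` votes one after the other, each as the list of its candidates from best to worst: the candidate
that voter `i` ranks at position `j` is in cell `i * m + j`. Everything else is `0`. -/
def inputStore {n m : ℕ} (votes : Fin n → Equiv.Perm (Fin m)) (k : ℕ) : Store where
  reg x := if x = 0 then n else if x = 1 then m else if x = 2 then k else 0
  arr a z :=
    if h : a = 0 ∧ z / m < n ∧ z % m < m then
      (votes ⟨z / m, h.2.1⟩ ⟨z % m, h.2.2⟩ : Fin m)
    else 0

/-- The set of candidates whose cells in array `1` contain `1`. -/
def outputSet (m : ℕ) (s : Store) : Finset (Fin m) :=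
  Finset.univ.filter fun c => s.arr 1 c = 1

end NearlySinglePeaked

/-!
A set of candidates is single-peaked consistent if and only if it can be arranged on a line in such
a way that no voter ranks a candidate below two candidates on different sides of it. Label every
candidate by its position in the first vote. In any admissible arrangement the largest label stands
at one of the two ends, since otherwise the first voter would rank it below candidates on both
sides. Hence every admissible arrangement is built from its two smallest labels by adding the other
labels at the ends, in increasing order (`Unimodal.exists_reach`). Conversely, when a label is added
at an end it suffices to compare it with its two nearest neighbours
(`Unimodal.insert_left`, `Reach.exists_unimodal`): a voter for whom the local test holds and who
ranks some `b` below both the new label and a label behind `b` would already have ranked a label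
below two others on the old axis. The possible continuations of a partial axis therefore depend only
on its two outermost labels at either end, `x, p` and `y, z`, where `x` is the label added last.

The largest size `longest` of an axis with given ends satisfies a recursion over the label that
becomes visible when `x` is removed: there are at most `m ^ 4` quadruples, `m` candidates for the
next label, and `n` voters to be asked, which gives the time `O(n * m ^ 5)`. The recorded
next labels allow an optimal axis to be traced back (`longest_step`), and deleting `k` candidates
suffices exactly when a maximum consistent set has at least `m - k` elements
(`candidateDeletionConsistent_iff`).

The program tabulates this recursion. Its analysis uses the predicate `Runs`, which combines
termination, a bound on the number of steps, a bound on the numbers that are stored, and the fact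
that nothing is changed except what the program writes. As all stored numbers are below
`n + m + k + 2`, the value of any expression is at most a fixed power of this number
(`Expr.eval_lt`), so that overflow is excluded once and for all. The central rule is
`Runs.forLoop`, and the parts of the program are treated in `rankProg_runs`, `tableProg_runs` and
`traceProg_runs`.
-/

namespace NearlySinglePeaked

/-! ### Axes built from the inside outwards -/

/-- No voter `i < n` ranks `b` below both `a` and `c`, where `q i` gives the ranks of voter `i`
(small ranks are good). -/
def MiddleOK (n : ℕ) (q : ℕ → ℕ → ℕ) (a b c : ℕ) : Prop :=
  ∀ i < n, ¬ (q i a < q i b ∧ q i c < q i b)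

instance (n : ℕ) (q : ℕ → ℕ → ℕ) (a b c : ℕ) : Decidable (MiddleOK n q a b c) := by
  unfold MiddleOK; infer_instance

theorem MiddleOK.symm {n : ℕ} {q : ℕ → ℕ → ℕ} {a b c : ℕ} (h : MiddleOK n q a b c) :
    MiddleOK n q c b a :=
  fun i hi hc => h i hi ⟨hc.2, hc.1⟩

/-- `Reach n m q x p y z S v`: the set `S` of `v` labels can be arranged on an axis by adding its
elements at the ends in increasing order of their labels, beginning with the two smallest. The
outermost labels are `x`, the one added last, with neighbour `p`, and at the other end `y`, with
neighbour `z`. Every new label is only compared with the two labels next to it. -/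
inductive Reach (n m : ℕ) (q : ℕ → ℕ → ℕ) : ℕ → ℕ → ℕ → ℕ → Finset ℕ → ℕ → Prop where
  | pair {a b : ℕ} (hab : a < b) (hb : b < m) : Reach n m q b a a b {b, a} 2
  | same {x p y z w v : ℕ} {S : Finset ℕ} (h : Reach n m q x p y z S v) (hx : x < w) (hw : w < m)
      (hok : MiddleOK n q w x p) : Reach n m q w x y z (insert w S) (v + 1)
  | other {x p y z w v : ℕ} {S : Finset ℕ} (h : Reach n m q x p y z S v) (hx : x < w) (hw : w < m)
      (hok : MiddleOK n q w y z) : Reach n m q w y x p (insert w S) (v + 1)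

namespace Reach

variable {n m : ℕ} {q : ℕ → ℕ → ℕ} {x p y z v : ℕ} {S : Finset ℕ}

theorem lt (h : Reach n m q x p y z S v) : p < x ∧ y < x ∧ x < m ∧ z < m := by
  induction h <;> omega

theorem le_of_mem (h : Reach n m q x p y z S v) : ∀ s ∈ S, s ≤ x := by
  induction h with
  | pair hab hb => intro s hs; simp at hs; omega
  | same h hx hw hok ih =>
    intro s hs
    rcases Finset.mem_insert.1 hs with rfl | hs
    · exact le_rfl
    · exact (ih s hs).trans hx.le
  | other h hx hw hok ih =>
    intro s hs
    rcases Finset.mem_insert.1 hs with rfl | hs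
    · exact le_rfl
    · exact (ih s hs).trans hx.le

theorem lt_of_mem (h : Reach n m q x p y z S v) : ∀ s ∈ S, s < m :=
  fun s hs => (h.le_of_mem s hs).trans_lt h.lt.2.2.1

theorem card_eq (h : Reach n m q x p y z S v) : S.card = v := by
  induction h with
  | pair hab hb => exact Finset.card_pair hab.ne'
  | same h hx hw hok ih =>
    rw [Finset.card_insert_of_notMem, ih]
    intro hm; exact absurd (h.le_of_mem _ hm) (by omega)
  | other h hx hw hok ih =>
    rw [Finset.card_insert_of_notMem, ih]
    intro hm; exact absurd (h.le_of_mem _ hm) (by omega)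

theorem two_le (h : Reach n m q x p y z S v) : 2 ≤ v := by
  induction h <;> omega

end Reach

/-- Placing the labels in `S` on a line at the positions `f`, no voter ranks a label below two
labels on different sides of it. -/
def Unimodal (n : ℕ) (q : ℕ → ℕ → ℕ) (f : ℕ → ℤ) (S : Finset ℕ) : Prop :=
  ∀ a ∈ S, ∀ b ∈ S, ∀ c ∈ S, f a < f b → f b < f c → MiddleOK n q a b c

/-- In the arrangement `f` of `S`, the leftmost labels are `l`, `l'` and the rightmost ones are
`r'`, `r`. -/
structure Ends (f : ℕ → ℤ) (S : Finset ℕ) (l l' r r' : ℕ) : Prop where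
  left_mem : l ∈ S
  left_mem' : l' ∈ S
  right_mem : r ∈ S
  right_mem' : r' ∈ S
  left_ne : l' ≠ l
  right_ne : r' ≠ r
  left_le : ∀ s ∈ S, f l ≤ f s
  left_le' : ∀ s ∈ S, s ≠ l → f l' ≤ f s
  le_right : ∀ s ∈ S, f s ≤ f r
  le_right' : ∀ s ∈ S, s ≠ r → f s ≤ f r'

section

variable {n m : ℕ} {q : ℕ → ℕ → ℕ} {f : ℕ → ℤ} {S : Finset ℕ} {l l' r r' w : ℕ}

theorem Unimodal.neg (h : Unimodal n q f S) : Unimodal n q (-f) S :=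
  fun a ha b hb c hc hab hbc =>
    (h c hc b hb a ha (by simpa using hbc) (by simpa using hab)).symm

theorem Unimodal.mono {T : Finset ℕ} (h : Unimodal n q f T) (hS : S ⊆ T) : Unimodal n q f S :=
  fun a ha b hb c hc => h a (hS ha) b (hS hb) c (hS hc)

theorem Ends.neg (h : Ends f S l l' r r') : Ends (-f) S r r' l l' where
  left_mem := h.right_mem
  left_mem' := h.right_mem'
  right_mem := h.left_mem
  right_mem' := h.left_mem'
  left_ne := h.right_ne
  right_ne := h.left_ne
  left_le s hs := by simpa using h.le_right s hs
  left_le' s hs hne := by simpa using h.le_right' s hs hne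
  le_right s hs := by simpa using h.left_le s hs
  le_right' s hs hne := by simpa using h.left_le' s hs hne

/-- A new label left of everything else becomes the left end. -/
theorem Ends.insert_left (h : Ends f S l l' r r') (hw : ∀ s ∈ S, f w < f s) :
    Ends f (insert w S) w l r r' := by
  have hne : ∀ s ∈ S, s ≠ w := fun s hs e => by
    have := hw s hs
    rw [e] at this
    exact lt_irrefl _ this
  refine ⟨by simp, by simp [h.left_mem], by simp [h.right_mem], by simp [h.right_mem'],
    hne _ h.left_mem, h.right_ne, ?_, ?_, ?_, ?_⟩
  · intro s hs
    rcases Finset.mem_insert.1 hs with rfl | hs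
    · exact le_rfl
    · exact (hw s hs).le
  · intro s hs hs'
    rcases Finset.mem_insert.1 hs with rfl | hs
    · exact absurd rfl hs'
    · exact h.left_le s hs
  · intro s hs
    rcases Finset.mem_insert.1 hs with rfl | hs
    · exact (hw r h.right_mem).le
    · exact h.le_right s hs
  · intro s hs hs'
    rcases Finset.mem_insert.1 hs with rfl | hs
    · exact (hw r' h.right_mem').le
    · exact h.le_right' s hs hs'

/-- The local test suffices: if a new left end `w` is compatible with its two neighbours, then it
is compatible with the whole axis. -/
theorem Unimodal.insert_left (hq : ∀ i < n, ∀ a < m, ∀ b < m, q i a = q i b → a = b)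
    (hSm : ∀ s ∈ S, s < m) (hf : Set.InjOn f S) (hU : Unimodal n q f S)
    (h : Ends f S l l' r r') (hw : ∀ s ∈ S, f w < f s) (hok : MiddleOK n q w l l') :
    Unimodal n q f (insert w S) := by
  have lift : ∀ {s}, s ∈ S → s ≠ l → f l < f s := fun {s} hs hne =>
    lt_of_le_of_ne (h.left_le s hs) fun e => hne (hf hs h.left_mem e.symm)
  -- the triples `w, l, c`
  have key : ∀ c ∈ S, c ≠ l → MiddleOK n q w l c := by
    intro c hc hcl i hi ⟨h1, h2⟩
    rcases eq_or_ne c l' with rfl | hcl'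
    · exact hok i hi ⟨h1, h2⟩
    · have h3 : f l' < f c := lt_of_le_of_ne (h.left_le' c hc hcl)
        fun e => hcl' (hf hc h.left_mem' e.symm)
      have h4 := hU l h.left_mem l' h.left_mem' c hc (lift h.left_mem' h.left_ne) h3 i hi
      have h5 := hok i hi
      have h6 : q i l ≠ q i l' := fun e =>
        h.left_ne (hq i hi _ (hSm _ h.left_mem) _ (hSm _ h.left_mem') e).symm
      omega
  have key2 : ∀ b ∈ S, ∀ c ∈ S, f b < f c → MiddleOK n q w b c := by
    intro b hb c hc hbc
    rcases eq_or_ne b l with rfl | hbl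
    · exact key c hc (fun e => by rw [e] at hbc; exact lt_irrefl _ hbc)
    · intro i hi ⟨h1, h2⟩
      have h3 := hU l h.left_mem b hb c hc (lift hb hbl) hbc i hi
      have h4 := key b hb hbl i hi
      have h6 : q i b ≠ q i l := fun e =>
        hbl (hq i hi _ (hSm _ hb) _ (hSm _ h.left_mem) e)
      omega
  have hle : ∀ s ∈ insert w S, f w ≤ f s := by
    intro s hs
    rcases Finset.mem_insert.1 hs with rfl | hs
    · exact le_rfl
    · exact (hw s hs).le
  intro a ha b hb c hc hab hbc
  have hb' : b ∈ S := by
    rcases Finset.mem_insert.1 hb with rfl | hb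
    · exact absurd (hle a ha) (not_le.2 hab)
    · exact hb
  have hc' : c ∈ S := by
    rcases Finset.mem_insert.1 hc with rfl | hc
    · exact absurd (hle b hb) (not_le.2 hbc)
    · exact hc
  rcases Finset.mem_insert.1 ha with rfl | ha
  · exact key2 b hb' c hc' hbc
  · exact hU a ha b hb' c hc' hab hbc

/-- Moving the label `w ∉ S` to the left of `S` gives an arrangement of `insert w S`. -/
theorem Unimodal.exists_insert (hq : ∀ i < n, ∀ a < m, ∀ b < m, q i a = q i b → a = b)
    (hSm : ∀ s ∈ S, s < m) (hf : Set.InjOn f S) (hU : Unimodal n q f S)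
    (h : Ends f S l l' r r') (hw : w ∉ S) (hok : MiddleOK n q w l l') :
    ∃ g : ℕ → ℤ, Set.InjOn g (insert w S : Finset ℕ) ∧ Unimodal n q g (insert w S) ∧
      Ends g (insert w S) w l r r' := by
  set g : ℕ → ℤ := Function.update f w (f l - 1) with hg
  have hgS : ∀ s ∈ S, g s = f s := fun s hs =>
    Function.update_of_ne (fun e => hw (by rwa [← e])) _ _
  have hgw : g w = f l - 1 := Function.update_self _ _ _
  have hlt : ∀ s ∈ S, g w < g s := fun s hs => by
    rw [hgS s hs, hgw]; have := h.left_le s hs; omega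
  have hgf : Set.InjOn g S := fun a ha b hb hab => by
    rw [hgS a ha, hgS b hb] at hab
    exact hf ha hb hab
  have hgU : Unimodal n q g S := fun a ha b hb c hc hab hbc => by
    rw [hgS a ha, hgS b hb] at hab
    rw [hgS b hb, hgS c hc] at hbc
    exact hU a ha b hb c hc hab hbc
  have hgE : Ends g S l l' r r' := by
    refine ⟨h.left_mem, h.left_mem', h.right_mem, h.right_mem', h.left_ne, h.right_ne,
      fun s hs => ?_, fun s hs => ?_, fun s hs => ?_, fun s hs => ?_⟩
    · rw [hgS s hs, hgS _ h.left_mem]; exact h.left_le s hs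
    · rw [hgS s hs, hgS _ h.left_mem']; exact h.left_le' s hs
    · rw [hgS s hs, hgS _ h.right_mem]; exact h.le_right s hs
    · rw [hgS s hs, hgS _ h.right_mem']; exact h.le_right' s hs
  refine ⟨g, ?_, hgU.insert_left hq hSm hgf hgE hlt hok, hgE.insert_left hlt⟩
  rw [Finset.coe_insert, Set.injOn_insert (by simpa using hw)]
  refine ⟨hgf, ?_⟩
  rintro ⟨s, hs, e⟩
  exact absurd (hlt s hs) (by rw [e]; exact lt_irrefl _)

/-- Every set built by local tests is unimodal for some arrangement. -/
theorem Reach.exists_unimodal (hq : ∀ i < n, ∀ a < m, ∀ b < m, q i a = q i b → a = b)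
    {x p y z v : ℕ} (h : Reach n m q x p y z S v) :
    ∃ f : ℕ → ℤ, Set.InjOn f S ∧ Unimodal n q f S ∧ Ends f S x p y z := by
  induction h with
  | @pair a b hab hb =>
    refine ⟨fun c => -(c : ℤ), fun c _ d _ h => by simpa using h, ?_, ?_⟩
    · intro c hc d hd e he hcd hde
      simp at hc hd he hcd hde
      omega
    · constructor <;> simp <;> omega
  | same h hx hw hok ih =>
    obtain ⟨f, hf, hU, hE⟩ := ih
    exact hU.exists_insert hq h.lt_of_mem hf hE
      (fun hm => absurd (h.le_of_mem _ hm) (by omega)) hok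
  | other h hx hw hok ih =>
    obtain ⟨f, hf, hU, hE⟩ := ih
    exact hU.neg.exists_insert hq h.lt_of_mem (fun a ha b hb hab => hf ha hb (by simpa using hab))
      hE.neg (fun hm => absurd (h.le_of_mem _ hm) (by omega)) hok

/-- Conversely, every arrangement arises by adding labels at the ends: as voter `0` ranks the
labels in their natural order, the largest label is always at an end. -/
theorem Unimodal.exists_reach (hn : 0 < n) (hq0 : ∀ a < m, q 0 a = a) (S : Finset ℕ) :
    (∀ s ∈ S, s < m) → Set.InjOn f S → Unimodal n q f S → 2 ≤ S.card →
    ∃ x p y z, Reach n m q x p y z S S.card ∧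
      (Ends f S x p y z ∨ Ends (-f) S x p y z) := by
  refine Finset.induction_on_max S ?_ ?_
  · intro _ _ _ h; simp at h
  · intro w S hwS ih hm hf hU hcard
    have hwn : w ∉ S := fun h => lt_irrefl _ (hwS w h)
    have hwm : w < m := hm w (by simp)
    have hm' : ∀ s ∈ S, s < m := fun s hs => hm s (by simp [hs])
    have hne : ∀ s ∈ S, f s ≠ f w := fun s hs e =>
      hwn (by rwa [← hf (by simp [hs]) (by simp) e])
    rw [Finset.card_insert_of_notMem hwn] at hcard ⊢
    have hcases : (∀ s ∈ S, f w < f s) ∨ (∀ s ∈ S, f s < f w) := by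
      by_contra! hcon
      obtain ⟨⟨s, hs, hs'⟩, ⟨t, ht, ht'⟩⟩ := hcon
      refine hU s (by simp [hs]) w (by simp) t (by simp [ht]) (lt_of_le_of_ne hs' (hne s hs))
        (lt_of_le_of_ne ht' (hne t ht).symm) 0 hn ?_
      rw [hq0 s (hm' s hs), hq0 w hwm, hq0 t (hm' t ht)]
      exact ⟨hwS s hs, hwS t ht⟩
    by_cases hS : 2 ≤ S.card
    · obtain ⟨x, p, y, z, hR, hE⟩ := ih hm' (hf.mono (by simp))
        (hU.mono (Finset.subset_insert _ _)) hS
      -- one step, for an arrangement or its mirror image, adding `w` on the left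
      have step : ∀ g : ℕ → ℤ, Set.InjOn g S → Unimodal n q g (insert w S) →
          (Ends g S x p y z ∨ Ends (-g) S x p y z) → (∀ s ∈ S, g w < g s) →
          ∃ x p y z, Reach n m q x p y z (insert w S) (S.card + 1) ∧
            Ends g (insert w S) x p y z := by
        intro g hgf hg hE hlt
        have lt_of {l l' r r' : ℕ} (hE : Ends g S l l' r r') : MiddleOK n q w l l' :=
          hg w (by simp) l (by simp [hE.left_mem]) l' (by simp [hE.left_mem'])
            (hlt _ hE.left_mem) (lt_of_le_of_ne (hE.left_le _ hE.left_mem')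
              fun e => hE.left_ne (hgf hE.left_mem' hE.left_mem e.symm))
        rcases hE with hE | hE
        · exact ⟨w, x, y, z, hR.same (hwS _ hE.left_mem) hwm (lt_of hE), hE.insert_left hlt⟩
        · have hE' := hE.neg
          rw [neg_neg] at hE'
          exact ⟨w, y, x, p, hR.other (hwS _ hE.left_mem) hwm (lt_of hE'), hE'.insert_left hlt⟩
      have hfS : Set.InjOn f S := hf.mono (by simp)
      rcases hcases with hlt | hlt
      · obtain ⟨x, p, y, z, hR, hE⟩ := step f hfS hU hE hlt
        exact ⟨x, p, y, z, hR, .inl hE⟩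
      · obtain ⟨x, p, y, z, hR, hE⟩ := step (-f)
          (fun a ha b hb hab => hfS ha hb (by simpa using hab)) hU.neg
          (by rw [neg_neg]; exact hE.symm) (fun s hs => by simpa using hlt s hs)
        exact ⟨x, p, y, z, hR, .inr hE⟩
    · obtain ⟨a, rfl⟩ := Finset.card_eq_one.1 (by omega : S.card = 1)
      have haw : a < w := hwS a (by simp)
      have hEnds : ∀ g : ℕ → ℤ, g w < g a → Ends g {w, a} w a a w := by
        intro g hg
        constructor <;> simp <;> omega
      refine ⟨w, a, a, w, by simpa using Reach.pair haw hwm, ?_⟩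
      rcases hcases with hlt | hlt
      · exact .inl (hEnds f (hlt a (by simp)))
      · exact .inr (hEnds (-f) (by simpa using hlt a (by simp)))

end

/-! ### The dynamic program -/

/-- The best of the candidates `w < k` for a maximum, together with its value: `w` is admissible if
`ok w` and `0 < v w`, and then has the value `v w + 1`. The value starts at `b`. -/
def scan (v : ℕ → ℕ) (ok : ℕ → Prop) [DecidablePred ok] (b : ℕ) : ℕ → ℕ × ℕ
  | 0 => (b, 0)
  | k + 1 => if ok k ∧ 0 < v k ∧ (scan v ok b k).1 < v k + 1 then (v k + 1, k) else scan v ok b k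

section scan

variable {v : ℕ → ℕ} {ok : ℕ → Prop} [DecidablePred ok] {b : ℕ}

theorem scan_ge_base (k : ℕ) : b ≤ (scan v ok b k).1 := by
  induction k with
  | zero => simp [scan]
  | succ k ih => rw [scan]; split_ifs <;> omega

theorem scan_ge {k w : ℕ} (hw : w < k) (hok : ok w) (hv : 0 < v w) :
    v w + 1 ≤ (scan v ok b k).1 := by
  induction k with
  | zero => omega
  | succ k ih =>
    rcases (Nat.lt_succ_iff_lt_or_eq.1 hw) with h | rfl
    · have := ih h
      rw [scan]; split_ifs <;> omega
    · rw [scan]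
      split_ifs with h
      · exact le_rfl
      · have : ¬ (scan v ok b w).1 < v w + 1 := fun h' => h ⟨hok, hv, h'⟩
        omega

theorem scan_cases (k : ℕ) : scan v ok b k = (b, 0) ∨
    ∃ w < k, ok w ∧ 0 < v w ∧ scan v ok b k = (v w + 1, w) := by
  induction k with
  | zero => simp [scan]
  | succ k ih =>
    by_cases h : ok k ∧ 0 < v k ∧ (scan v ok b k).1 < v k + 1
    · exact .inr ⟨k, by omega, h.1, h.2.1, by rw [scan, if_pos h]⟩
    · rw [scan, if_neg h]
      rcases ih with ih | ⟨w, hw, ih⟩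
      · exact .inl ih
      · exact .inr ⟨w, by omega, ih⟩

theorem scan_congr {v' : ℕ → ℕ} {k : ℕ} (h : ∀ w < k, v w = v' w) :
    scan v ok b k = scan v' ok b k := by
  induction k with
  | zero => rfl
  | succ k ih => rw [scan, scan, ih fun w hw => h w (by omega), h k (by omega)]

end scan

/-- When the last label is removed from an axis with ends `x, p` and `y, z`, and `w` is the
label next to `p`, then the last label of the remaining axis is `p` or `y`. This looks up the value
`g` of the remaining axis. -/
def prevValue (g : ℕ → ℕ → ℕ → ℕ → ℕ) (p y z w : ℕ) : ℕ :=
  if y < p then g p w y z else g y z p w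

/-- The maximal size of an axis with ends `x, p` and `y, z` (`0` if there is none), and for sizes
above `2` the neighbour of `p` on such an axis. -/
def longest (n m : ℕ) (q : ℕ → ℕ → ℕ) (x p y z : ℕ) : ℕ × ℕ :=
  if _h : p < x ∧ y < x then
    scan (fun w => if y < p then (longest n m q p w y z).1 else (longest n m q y z p w).1)
      (fun w => MiddleOK n q x p w) (if p = y ∧ z = x then 2 else 0) m
  else (0, 0)
termination_by x

section longest

variable {n m : ℕ} {q : ℕ → ℕ → ℕ} {x p y z : ℕ}

theorem longest_eq (h : p < x ∧ y < x) : longest n m q x p y z =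
    scan (prevValue (fun x p y z => (longest n m q x p y z).1) p y z)
      (fun w => MiddleOK n q x p w) (if p = y ∧ z = x then 2 else 0) m := by
  rw [longest, dif_pos h]
  rfl

theorem longest_eq_zero (h : ¬ (p < x ∧ y < x)) : longest n m q x p y z = (0, 0) := by
  rw [longest, dif_neg h]

theorem longest_le (x p y z : ℕ) : (longest n m q x p y z).1 ≤ x + 1 := by
  induction x using Nat.strong_induction_on generalizing p y z with
  | _ x ih =>
    by_cases h : p < x ∧ y < x
    · rw [longest_eq h]
      rcases scan_cases (v := prevValue (fun x p y z => (longest n m q x p y z).1) p y z)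
        (ok := fun w => MiddleOK n q x p w) (b := if p = y ∧ z = x then 2 else 0) m with
        hs | ⟨w, hw, -, -, hs⟩
      · rw [hs]; simp only; split_ifs <;> omega
      · rw [hs]
        simp only [prevValue]
        split_ifs
        · have := ih p h.1 w y z; omega
        · have := ih y h.2 z p w; omega
    · simp [longest_eq_zero h]

/-- No axis with the given ends is larger. -/
theorem Reach.le_longest {S : Finset ℕ} {v : ℕ} (h : Reach n m q x p y z S v) :
    v ≤ (longest n m q x p y z).1 := by
  have step : ∀ {x p y z w v : ℕ}, p < x ∧ y < x → w < m → MiddleOK n q x p w →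
      v ≤ prevValue (fun x p y z => (longest n m q x p y z).1) p y z w → 0 < v →
      v + 1 ≤ (longest n m q x p y z).1 := by
    intro x p y z w v hx hw hok hv hv0
    rw [longest_eq hx]
    exact (Nat.succ_le_succ hv).trans (scan_ge hw hok (hv0.trans_le hv))
  induction h with
  | pair hab hb =>
    rw [longest_eq ⟨hab, hab⟩]
    exact le_trans (by simp) (scan_ge_base m)
  | same h hx hw hok ih =>
    have hl := h.lt
    exact step (by omega) (hl.1.trans hl.2.2.1) hok (by simpa [prevValue, hl.2.1] using ih)
      (by have := h.two_le; omega)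
  | other h hx hw hok ih =>
    have hl := h.lt
    exact step (by omega) hl.2.2.2 hok (by simpa [prevValue, hl.2.1.le.not_gt] using ih)
      (by have := h.two_le; omega)

theorem longest_lt (h : 0 < (longest n m q x p y z).1) : p < x ∧ y < x := by
  by_contra h'
  simp [longest_eq_zero h'] at h

theorem longest_cases (h : 0 < (longest n m q x p y z).1) :
    (p = y ∧ z = x ∧ (longest n m q x p y z).1 = 2) ∨
      ∃ w < m, MiddleOK n q x p w ∧ (longest n m q x p y z).2 = w ∧
        (longest n m q x p y z).1 =
          prevValue (fun x p y z => (longest n m q x p y z).1) p y z w + 1 ∧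
        0 < prevValue (fun x p y z => (longest n m q x p y z).1) p y z w := by
  have hlt := longest_lt h
  rw [longest_eq hlt] at h ⊢
  rcases scan_cases (v := prevValue (fun x p y z => (longest n m q x p y z).1) p y z)
    (ok := fun w => MiddleOK n q x p w) (b := if p = y ∧ z = x then 2 else 0) m with
    hs | ⟨w, hw, hok, hpos, hs⟩
  · rw [hs] at h ⊢
    by_cases hb : p = y ∧ z = x
    · simp [hb]
    · simp [hb] at h
  · rw [hs]
    exact .inr ⟨w, hw, hok, rfl, rfl, hpos⟩

theorem longest_ne_one (x p y z : ℕ) : (longest n m q x p y z).1 ≠ 1 := by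
  intro h
  rcases longest_cases (n := n) (m := m) (q := q) (x := x) (p := p) (y := y) (z := z)
    (by omega) with h' | ⟨w, -, -, -, h1, h2⟩ <;> omega

theorem reach_of_longest_eq_two (hx : x < m) (h : (longest n m q x p y z).1 = 2) :
    Reach n m q x p y z {x, y} 2 := by
  have hlt := longest_lt (n := n) (m := m) (q := q) (x := x) (p := p) (y := y) (z := z) (by omega)
  rcases longest_cases (n := n) (m := m) (q := q) (x := x) (p := p) (y := y) (z := z)
    (by omega) with ⟨rfl, rfl, -⟩ | ⟨w, -, -, -, h1, h2⟩
  · exact .pair hlt.1 hx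
  · exfalso
    have h3 : prevValue (fun x p y z => (longest n m q x p y z).1) p y z w = 1 := by omega
    unfold prevValue at h3
    split_ifs at h3
    · exact longest_ne_one _ _ _ _ h3
    · exact longest_ne_one _ _ _ _ h3

/-- Above size `2`, the recorded neighbour leads to an axis with one label less. -/
theorem longest_step (hx : x < m) (h : 2 < (longest n m q x p y z).1) {w : ℕ}
    (hw : (longest n m q x p y z).2 = w) :
    w < m ∧ if y < p then
      (longest n m q p w y z).1 + 1 = (longest n m q x p y z).1 ∧
        ∀ S v, Reach n m q p w y z S v → Reach n m q x p y z (insert x S) (v + 1)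
    else
      (longest n m q y z p w).1 + 1 = (longest n m q x p y z).1 ∧
        ∀ S v, Reach n m q y z p w S v → Reach n m q x p y z (insert x S) (v + 1) := by
  have hlt := longest_lt (n := n) (m := m) (q := q) (x := x) (p := p) (y := y) (z := z) (by omega)
  rcases longest_cases (n := n) (m := m) (q := q) (x := x) (p := p) (y := y) (z := z)
    (by omega) with ⟨rfl, rfl, h2⟩ | ⟨w', hw', hok, e, h1, h2⟩
  · omega
  · obtain rfl : w' = w := e.symm.trans hw
    refine ⟨hw', ?_⟩
    unfold prevValue at h1
    split_ifs at h1 ⊢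
    · exact ⟨h1.symm, fun S v hR => hR.same hlt.1 hx hok⟩
    · exact ⟨h1.symm, fun S v hR => hR.other hlt.2 hx hok⟩

end longest

/-! ### Elections -/

section election

variable {n m : ℕ} (votes : Fin n → Equiv.Perm (Fin m)) (hn : 0 < n)

/-- The candidates are labelled by their positions in the first vote. -/
def label (c : Fin m) : ℕ := (votes ⟨0, hn⟩).symm c

theorem label_lt (c : Fin m) : label votes hn c < m := Fin.is_lt _

theorem label_injective : Function.Injective (label votes hn) := fun _ _ h =>
  (votes ⟨0, hn⟩).symm.injective (Fin.ext h)

theorem exists_label {a : ℕ} (ha : a < m) : ∃ c, label votes hn c = a :=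
  ⟨votes ⟨0, hn⟩ ⟨a, ha⟩, by simp [label]⟩

variable {votes hn} {q : ℕ → ℕ → ℕ}

/-- A profile restricted to `C` is single-peaked consistent if and only if the labels of `C` have a
unimodal arrangement. -/
theorem singlePeakedConsistent_iff
    (hq : ∀ (i : Fin n) (c : Fin m), q i (label votes hn c) = (votes i).symm c)
    (C : Finset (Fin m)) :
    ((profileOf votes).restrict {c | c ∈ C}).SinglePeakedConsistent ↔
      ∃ f : ℕ → ℤ, Set.InjOn f (C.image (label votes hn) : Finset ℕ) ∧
        Unimodal n q f (C.image (label votes hn)) := by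
  have hrel : ∀ (i : Fin n) (a b : ({c | c ∈ C} : Set (Fin m))),
      ((profileOf votes).restrict {c | c ∈ C} i).rel a b ↔
        q i (label votes hn a) < q i (label votes hn b) := by
    intro i a b
    rw [hq, hq]
    rfl
  have hqinj : ∀ (i : Fin n) (a b : ({c | c ∈ C} : Set (Fin m))),
      q i (label votes hn a) = q i (label votes hn b) → a = b := by
    intro i a b h
    rw [hq, hq] at h
    exact Subtype.ext ((votes i).symm.injective (Fin.ext h))
  constructor
  · rintro ⟨axis, hax⟩
    have := axis.isStrictTotalOrder
    classical
    -- the position of a candidate is the number of candidates before it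
    let g : ({c | c ∈ C} : Set (Fin m)) → ℕ := fun c => (Finset.univ.filter (axis.rel · c)).card
    have hg : ∀ a b, axis.rel a b → g a < g b := by
      intro a b hab
      refine Finset.card_lt_card ⟨fun c hc => ?_, fun hsub => ?_⟩
      · simp only [Finset.mem_filter, Finset.mem_univ, true_and] at hc ⊢
        exact _root_.trans hc hab
      · have : a ∈ Finset.univ.filter (axis.rel · a) := hsub (by simpa using hab)
        exact irrefl a (by simpa using this)
    have hg' : ∀ a b, g a < g b → axis.rel a b := by
      intro a b hab
      rcases trichotomous_of axis.rel a b with h | rfl | h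
      · exact h
      · exact absurd hab (lt_irrefl _)
      · exact absurd (hg _ _ h) hab.le.not_gt
    let f : ℕ → ℤ := fun l =>
      if h : ∃ c : ({c | c ∈ C} : Set (Fin m)), label votes hn c = l then (g h.choose : ℤ) else 0
    have hf : ∀ c : ({c | c ∈ C} : Set (Fin m)), f (label votes hn c) = g c := by
      intro c
      have h : ∃ c' : ({c | c ∈ C} : Set (Fin m)), label votes hn c' = label votes hn c := ⟨c, rfl⟩
      have : h.choose = c := Subtype.ext (label_injective votes hn h.choose_spec)
      simp only [f, dif_pos h, this]
    refine ⟨f, ?_, ?_⟩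
    · rintro a ha b hb hab
      obtain ⟨a, ha', rfl⟩ := Finset.mem_image.1 ha
      obtain ⟨b, hb', rfl⟩ := Finset.mem_image.1 hb
      rw [hf ⟨a, ha'⟩, hf ⟨b, hb'⟩] at hab
      rcases trichotomous_of axis.rel ⟨a, ha'⟩ ⟨b, hb'⟩ with h | h | h
      · have := hg _ _ h; omega
      · rw [Subtype.mk.injEq] at h; rw [h]
      · have := hg _ _ h; omega
    · rintro a ha b hb c hc hab hbc i hi ⟨hqa, hqc⟩
      obtain ⟨a, ha', rfl⟩ := Finset.mem_image.1 ha
      obtain ⟨b, hb', rfl⟩ := Finset.mem_image.1 hb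
      obtain ⟨c, hc', rfl⟩ := Finset.mem_image.1 hc
      rw [hf ⟨a, ha'⟩, hf ⟨b, hb'⟩] at hab
      rw [hf ⟨b, hb'⟩, hf ⟨c, hc'⟩] at hbc
      have hab' := hg' ⟨a, ha'⟩ ⟨b, hb'⟩ (by omega)
      have hbc' := hg' ⟨b, hb'⟩ ⟨c, hc'⟩ (by omega)
      obtain ⟨t, -, ht⟩ := Finset.exists_min_image (Finset.univ)
        (fun t : ({c | c ∈ C} : Set (Fin m)) => q i (label votes hn t)) ⟨⟨a, ha'⟩, by simp⟩
      have hpeak : ((profileOf votes).restrict {c | c ∈ C} ⟨i, hi⟩).IsPeak t := by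
        intro c' hne
        rw [hrel]
        exact lt_of_le_of_ne (ht c' (by simp)) fun e => hne (hqinj ⟨i, hi⟩ _ _ e).symm
      have hsp := hax ⟨i, hi⟩ t hpeak
      rcases trichotomous_of axis.rel t ⟨b, hb'⟩ with h | h | h
      · have := (hsp ⟨c, hc'⟩ ⟨b, hb'⟩ (.inr ⟨h, hbc'⟩)).2
        rw [hrel] at this
        simp only at this
        omega
      · have := ht ⟨a, ha'⟩ (by simp)
        rw [h] at this
        simp only at this
        omega
      · have := (hsp ⟨a, ha'⟩ ⟨b, hb'⟩ (.inl ⟨hab', h⟩)).2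
        rw [hrel] at this
        simp only at this
        omega
  · rintro ⟨f, hf, hU⟩
    have hmem : ∀ c : ({c | c ∈ C} : Set (Fin m)),
        label votes hn c ∈ C.image (label votes hn) :=
      fun c => Finset.mem_image_of_mem _ c.2
    let e : ({c | c ∈ C} : Set (Fin m)) ↪ ℤ :=
      ⟨fun c => f (label votes hn c), fun a b hab =>
        Subtype.ext (label_injective votes hn (hf (hmem a) (hmem b) hab))⟩
    refine ⟨⟨fun a b => e a < e b, (RelEmbedding.preimage e (· < ·)).isStrictTotalOrder⟩, ?_⟩
    intro i c hc x y hxy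
    have hyc : y ≠ c := by
      rintro rfl
      rcases hxy with ⟨-, h⟩ | ⟨h, -⟩ <;> exact lt_irrefl _ h
    have hcy := hc y hyc
    refine ⟨hcy, ?_⟩
    have hnxy : x ≠ y := by
      rintro rfl
      rcases hxy with ⟨h, -⟩ | ⟨-, h⟩ <;> exact lt_irrefl _ h
    rw [hrel] at hcy ⊢
    have key : ¬ (q i (label votes hn x) < q i (label votes hn y) ∧
        q i (label votes hn c) < q i (label votes hn y)) := by
      rcases hxy with ⟨h1, h2⟩ | ⟨h1, h2⟩
      · exact hU _ (hmem x) _ (hmem y) _ (hmem c) h1 h2 i i.2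
      · exact fun h => hU _ (hmem c) _ (hmem y) _ (hmem x) h1 h2 i i.2 h.symm
    have hne : q i (label votes hn x) ≠ q i (label votes hn y) := fun h => hnxy (hqinj i _ _ h)
    omega

theorem rank_injective
    (hq : ∀ (i : Fin n) (c : Fin m), q i (label votes hn c) = (votes i).symm c) :
    ∀ i < n, ∀ a < m, ∀ b < m, q i a = q i b → a = b := by
  intro i hi a ha b hb h
  obtain ⟨a, rfl⟩ := exists_label votes hn ha
  obtain ⟨b, rfl⟩ := exists_label votes hn hb
  rw [hq ⟨i, hi⟩, hq ⟨i, hi⟩] at h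
  rw [(votes ⟨i, hi⟩).symm.injective (Fin.ext h)]

theorem rank_zero (hq : ∀ (i : Fin n) (c : Fin m), q i (label votes hn c) = (votes i).symm c) :
    ∀ a < m, q 0 a = a := by
  intro a ha
  obtain ⟨a, rfl⟩ := exists_label votes hn ha
  exact hq ⟨0, hn⟩ a

theorem Reach.singlePeakedConsistent
    (hq : ∀ (i : Fin n) (c : Fin m), q i (label votes hn c) = (votes i).symm c)
    {x p y z v : ℕ} {C : Finset (Fin m)}
    (h : Reach n m q x p y z (C.image (label votes hn)) v) :
    ((profileOf votes).restrict {c | c ∈ C}).SinglePeakedConsistent := by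
  obtain ⟨f, hf, hU, -⟩ := h.exists_unimodal (rank_injective hq)
  exact (singlePeakedConsistent_iff hq C).2 ⟨f, hf, hU⟩

theorem singlePeakedConsistent_singleton
    (hq : ∀ (i : Fin n) (c : Fin m), q i (label votes hn c) = (votes i).symm c) (c : Fin m) :
    ((profileOf votes).restrict {c' | c' ∈ ({c} : Finset (Fin m))}).SinglePeakedConsistent := by
  refine (singlePeakedConsistent_iff hq {c}).2 ⟨fun _ => 0, by simp, ?_⟩
  intro a _ b _ c _ h
  exact absurd h (lt_irrefl _)

theorem exists_reach_of_singlePeakedConsistent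
    (hq : ∀ (i : Fin n) (c : Fin m), q i (label votes hn c) = (votes i).symm c)
    {C : Finset (Fin m)} (hC : 2 ≤ C.card)
    (h : ((profileOf votes).restrict {c | c ∈ C}).SinglePeakedConsistent) :
    ∃ x p y z S, Reach n m q x p y z S C.card := by
  obtain ⟨f, hf, hU⟩ := (singlePeakedConsistent_iff hq C).1 h
  have hcard := Finset.card_image_of_injective C (label_injective votes hn)
  obtain ⟨x, p, y, z, hR, -⟩ := Unimodal.exists_reach hn (rank_zero hq) _
    (by simp only [Finset.mem_image]; rintro s ⟨c, -, rfl⟩; exact label_lt votes hn c) hf hU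
    (by omega)
  exact ⟨x, p, y, z, _, hcard ▸ hR⟩

/-- Deleting at most `k` candidates suffices if and only if a maximum consistent set misses at most
`k` candidates. -/
theorem candidateDeletionConsistent_iff {P : Profile (Fin n) (Fin m)} {C : Finset (Fin m)}
    (hC : P.IsMaximumSinglePeakedSubset C) (k : ℕ) :
    P.CandidateDeletionConsistent k ↔ m ≤ C.card + k := by
  have hcompl : ∀ D : Finset (Fin m), D.card + Dᶜ.card = m := fun D => by
    rw [Finset.card_add_card_compl, Fintype.card_fin]
  constructor
  · rintro ⟨D, hD, h⟩
    have e : {c | c ∉ D} = {c | c ∈ Dᶜ} := by ext c; simp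
    rw [e] at h
    have := hC.2 _ h
    have := hcompl D
    omega
  · intro h
    refine ⟨Cᶜ, by have := hcompl C; omega, ?_⟩
    have e : {c | c ∉ Cᶜ} = {c | c ∈ C} := by ext c; simp
    rw [e]
    exact hC.1

end election

/-! ### Reasoning about programs -/

@[simp] theorem Store.setReg_reg (s : Store) (x v y : ℕ) :
    (s.setReg x v).reg y = if y = x then v else s.reg y := by
  simp [Store.setReg, Function.update_apply]

@[simp] theorem Store.setReg_arr (s : Store) (x v : ℕ) : (s.setReg x v).arr = s.arr := rfl

@[simp] theorem Store.setArr_reg (s : Store) (a i v : ℕ) : (s.setArr a i v).reg = s.reg := rfl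

@[simp] theorem Store.setArr_arr (s : Store) (a i v b j : ℕ) :
    (s.setArr a i v).arr b j = if b = a ∧ j = i then v else s.arr b j := by
  by_cases hb : b = a
  · subst hb
    simp [Store.setArr, Function.update_apply]
  · simp [Store.setArr, hb]

/-- All registers and array cells hold numbers below `B`. -/
def Store.Bounded (B : ℕ) (s : Store) : Prop :=
  (∀ x, s.reg x < B) ∧ ∀ a i, s.arr a i < B

theorem Store.Bounded.setReg {B x v : ℕ} {s : Store} (hs : s.Bounded B) (hv : v < B) :
    (s.setReg x v).Bounded B := by
  refine ⟨fun y => ?_, hs.2⟩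
  rw [setReg_reg]
  split_ifs
  exacts [hv, hs.1 y]

theorem Store.Bounded.setArr {B a i v : ℕ} {s : Store} (hs : s.Bounded B) (hv : v < B) :
    (s.setArr a i v).Bounded B := by
  refine ⟨hs.1, fun b j => ?_⟩
  rw [setArr_arr]
  split_ifs
  exacts [hv, hs.2 b j]

/-- An exponent `d` such that in a store bounded by `B` the values of the expression and of its
subexpressions are below `B ^ d`. -/
def Expr.width : Expr → ℕ
  | const v => v + 1
  | reg _ => 1
  | load _ i => i.width + 1
  | add e f => e.width + f.width
  | sub e f => e.width + f.width
  | mul e f => e.width + f.width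
  | lt e f => e.width + f.width
  | eq e f => e.width + f.width

theorem Expr.width_pos (e : Expr) : 0 < e.width := by
  induction e <;> simp only [width] <;> omega

theorem Expr.eval_lt {B : ℕ} {s : Store} (hB : 2 ≤ B) (hs : s.Bounded B) (e : Expr) :
    e.eval s < B ^ e.width := by
  have hB1 : 1 ≤ B := by omega
  have one_lt : ∀ e f : Expr, 1 < B ^ (e.width + f.width) := fun e f =>
    Nat.one_lt_pow (by have := e.width_pos; omega) hB
  have le_left : ∀ e f : Expr, B ^ e.width ≤ B ^ (e.width + f.width) := fun e f =>
    Nat.pow_le_pow_right hB1 (by omega)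
  induction e with
  | const v => exact (Nat.lt_pow_self hB).trans_le (Nat.pow_le_pow_right hB1 (Nat.le_succ v))
  | reg x => simpa [width, eval] using hs.1 x
  | load a i ih =>
    exact (hs.2 a _).trans_le (Nat.le_self_pow (by simp [width]) B)
  | add e f he hf =>
    simp only [eval, width]
    have h1 : 2 ≤ B ^ e.width := hB.trans (Nat.le_self_pow e.width_pos.ne' B)
    have h2 : 2 ≤ B ^ f.width := hB.trans (Nat.le_self_pow f.width_pos.ne' B)
    rw [pow_add]
    nlinarith
  | sub e f he hf => exact ((Nat.sub_le _ _).trans_lt he).trans_le (le_left e f)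
  | mul e f he hf =>
    simp only [eval, width]
    rw [pow_add]
    exact Nat.mul_lt_mul'' he hf
  | lt e f he hf =>
    simp only [eval, width]
    split_ifs
    exacts [one_lt e f, (one_lt e f).trans' one_pos]
  | eq e f he hf =>
    simp only [eval, width]
    split_ifs
    exacts [one_lt e f, (one_lt e f).trans' one_pos]

theorem Expr.fits {B W : ℕ} {s : Store} (hB : 2 ≤ B) (hs : s.Bounded B) (e : Expr)
    (hW : B ^ e.width ≤ W) : e.Fits W s := by
  have hlt := (eval_lt hB hs e).trans_le hW
  have left : ∀ e f : Expr, B ^ (e.width + f.width) ≤ W → B ^ e.width ≤ W := fun e f h =>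
    (Nat.pow_le_pow_right (by omega) (by omega)).trans h
  have right : ∀ e f : Expr, B ^ (e.width + f.width) ≤ W → B ^ f.width ≤ W := fun e f h =>
    (Nat.pow_le_pow_right (by omega) (by omega)).trans h
  have one_lt : ∀ e f : Expr, B ^ (e.width + f.width) ≤ W → 1 < W := fun e f h =>
    (Nat.one_lt_pow (by have := e.width_pos; omega) hB).trans_le h
  induction e with
  | const v => exact hlt
  | reg x => exact hlt
  | load a i ih =>
    have h : B ^ i.width ≤ W := (Nat.pow_le_pow_right (by omega) (by simp [width])).trans hW
    exact ⟨ih h ((eval_lt hB hs i).trans_le h), hlt⟩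
  | add e f he hf | mul e f he hf =>
    have h1 := left e f hW
    have h2 := right e f hW
    exact ⟨he h1 ((eval_lt hB hs e).trans_le h1), hf h2 ((eval_lt hB hs f).trans_le h2), hlt⟩
  | sub e f he hf =>
    have h1 := left e f hW
    have h2 := right e f hW
    exact ⟨he h1 ((eval_lt hB hs e).trans_le h1), hf h2 ((eval_lt hB hs f).trans_le h2)⟩
  | lt e f he hf | eq e f he hf =>
    have h1 := left e f hW
    have h2 := right e f hW
    exact ⟨he h1 ((eval_lt hB hs e).trans_le h1), hf h2 ((eval_lt hB hs f).trans_le h2),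
      one_lt e f hW⟩

namespace Program

/-- The registers that a program may write. -/
def regs : Program → List ℕ
  | skip => []
  | assign x _ => [x]
  | store _ _ _ => []
  | seq p q => p.regs ++ q.regs
  | ite _ p q => p.regs ++ q.regs
  | .while _ p => p.regs

/-- The arrays that a program may write. -/
def arrs : Program → List ℕ
  | skip => []
  | assign _ _ => []
  | store a _ _ => [a]
  | seq p q => p.arrs ++ q.arrs
  | ite _ p q => p.arrs ++ q.arrs
  | .while _ p => p.arrs

/-- `for x := 0, ..., b - 1 do p`, where the bound is the content of register `b`. -/
def forLoop (x b : ℕ) (p : Program) : Program :=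
  seq (assign x (.const 0))
    (.while (.lt (.reg x) (.reg b)) (seq p (assign x (.add (.reg x) (.const 1)))))

/-- The stores agree outside the registers and arrays that `p` may write. -/
def Frame (p : Program) (s s' : Store) : Prop :=
  (∀ x ∉ p.regs, s'.reg x = s.reg x) ∧ ∀ a ∉ p.arrs, s'.arr a = s.arr a

theorem Frame.refl (p : Program) (s : Store) : p.Frame s s :=
  ⟨fun _ _ => rfl, fun _ _ => rfl⟩

theorem Frame.trans {p : Program} {s s' s'' : Store} (h : p.Frame s s') (h' : p.Frame s' s'') :
    p.Frame s s'' :=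
  ⟨fun x hx => (h'.1 x hx).trans (h.1 x hx), fun a ha => (h'.2 a ha).trans (h.2 a ha)⟩

theorem Frame.mono {p p' : Program} {s s' : Store} (h : p.Frame s s') (hr : p.regs ⊆ p'.regs)
    (ha : p.arrs ⊆ p'.arrs) : p'.Frame s s' :=
  ⟨fun x hx => h.1 x fun hx' => hx (hr hx'), fun a ha' => h.2 a fun hx' => ha' (ha hx')⟩

end Program

open Program

theorem Exec.frame {W t : ℕ} {p : Program} {s s' : Store} (h : Exec W p s t s') :
    p.Frame s s' := by
  induction h with
  | skip s => exact .refl _ _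
  | assign s x e he =>
    refine ⟨fun y hy => ?_, fun _ _ => rfl⟩
    simp only [regs, List.mem_singleton] at hy
    simp [hy]
  | store s a i e hi he =>
    refine ⟨fun _ _ => rfl, fun b hb => ?_⟩
    simp only [arrs, List.mem_singleton] at hb
    funext j
    simp [hb]
  | seq hp hq ihp ihq =>
    exact (ihp.mono (by simp [regs]) (by simp [arrs])).trans
      (ihq.mono (by simp [regs]) (by simp [arrs]))
  | ite_true q hb hv hp ih => exact ih.mono (by simp [regs]) (by simp [arrs])
  | ite_false p hb hv hq ih => exact ih.mono (by simp [regs]) (by simp [arrs])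
  | while_true hb hv hp hw ihp ihw => exact (ihp.mono (by simp [regs]) (by simp [arrs])).trans ihw
  | while_false p hb hv => exact .refl _ _

/-- Started in `s`, the program halts within `T` steps in a store that satisfies `Q`, has all its
entries below `B + 2`, and agrees with `s` on everything that `p` does not write. The word bound
`(B + 2) ^ (d + 40)` leaves room for all expressions of width at most `40`, so that only the
numbers that are stored need attention. -/
def Runs (B d : ℕ) (p : Program) (s : Store) (T : ℕ) (Q : Store → Prop) : Prop :=
  ∃ t s', Exec ((B + 2) ^ (d + 40)) p s t s' ∧ t ≤ T ∧ s'.Bounded (B + 2) ∧ p.Frame s s' ∧ Q s'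

namespace Runs

variable {B d : ℕ} {p q : Program} {s : Store} {T T' : ℕ} {Q R : Store → Prop}

theorem le (h : Runs B d p s T Q) (hT : T ≤ T') : Runs B d p s T' Q := by
  obtain ⟨t, s', h1, h2, h3⟩ := h
  exact ⟨t, s', h1, h2.trans hT, h3⟩

theorem imp (h : Runs B d p s T R) (hQ : ∀ s', s'.Bounded (B + 2) → p.Frame s s' → R s' → Q s') :
    Runs B d p s T Q := by
  obtain ⟨t, s', h1, h2, h3, h4, h5⟩ := h
  exact ⟨t, s', h1, h2, h3, h4, hQ s' h3 h4 h5⟩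

theorem fits (hs : s.Bounded (B + 2)) {e : Expr} (he : e.width ≤ 40) :
    e.Fits ((B + 2) ^ (d + 40)) s :=
  e.fits (by omega) hs (Nat.pow_le_pow_right (by omega) (by omega))

theorem skip (hs : s.Bounded (B + 2)) (hQ : Q s) : Runs B d .skip s 1 Q :=
  ⟨1, s, .skip s, le_rfl, hs, .refl _ _, hQ⟩

theorem assign {x : ℕ} {e : Expr} (hs : s.Bounded (B + 2)) (he : e.width ≤ 40)
    (hv : e.eval s < B + 2) (hQ : Q (s.setReg x (e.eval s))) :
    Runs B d (.assign x e) s (e.cost + 1) Q :=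
  have h := Exec.assign (W := (B + 2) ^ (d + 40)) s x e (fits hs he)
  ⟨_, _, h, le_rfl, hs.setReg hv, h.frame, hQ⟩

theorem store {a : ℕ} {i e : Expr} (hs : s.Bounded (B + 2)) (hi : i.width ≤ 40)
    (he : e.width ≤ 40) (hv : e.eval s < B + 2) (hQ : Q (s.setArr a (i.eval s) (e.eval s))) :
    Runs B d (.store a i e) s (i.cost + e.cost + 1) Q :=
  have h := Exec.store (W := (B + 2) ^ (d + 40)) s a i e (fits hs hi) (fits hs he)
  ⟨_, _, h, le_rfl, hs.setArr hv, h.frame, hQ⟩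

theorem seq (hp : Runs B d p s T R)
    (hq : ∀ s', s'.Bounded (B + 2) → p.Frame s s' → R s' → Runs B d q s' T' Q) :
    Runs B d (.seq p q) s (T + T') Q := by
  obtain ⟨t, s', h1, h2, h3, h4, h5⟩ := hp
  obtain ⟨t', s'', h1', h2', h3', h4', h5'⟩ := hq s' h3 h4 h5
  have h := Exec.seq h1 h1'
  exact ⟨_, _, h, Nat.add_le_add h2 h2', h3', h.frame, h5'⟩

theorem assign_seq {x : ℕ} {e : Expr} (hs : s.Bounded (B + 2)) (he : e.width ≤ 40)
    (hv : e.eval s < B + 2)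
    (hq : (s.setReg x (e.eval s)).Bounded (B + 2) → Runs B d q (s.setReg x (e.eval s)) T Q) :
    Runs B d (.seq (.assign x e) q) s (e.cost + 1 + T) Q :=
  seq (R := fun s' => s' = s.setReg x (e.eval s)) (assign hs he hv rfl)
    fun _ hs' _ h => h ▸ hq (h ▸ hs')

theorem store_seq {a : ℕ} {i e : Expr} (hs : s.Bounded (B + 2)) (hi : i.width ≤ 40)
    (he : e.width ≤ 40) (hv : e.eval s < B + 2)
    (hq : (s.setArr a (i.eval s) (e.eval s)).Bounded (B + 2) →
      Runs B d q (s.setArr a (i.eval s) (e.eval s)) T Q) :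
    Runs B d (.seq (.store a i e) q) s (i.cost + e.cost + 1 + T) Q :=
  seq (R := fun s' => s' = s.setArr a (i.eval s) (e.eval s)) (store hs hi he hv rfl)
    fun _ hs' _ h => h ▸ hq (h ▸ hs')

theorem ite {b : Expr} (hs : s.Bounded (B + 2)) (hb : b.width ≤ 40)
    (hp : b.eval s ≠ 0 → Runs B d p s T Q) (hq : b.eval s = 0 → Runs B d q s T' Q) :
    Runs B d (.ite b p q) s (b.cost + 1 + (T + T')) Q := by
  by_cases hv : b.eval s = 0
  · obtain ⟨t, s', h1, h2, h3, h4, h5⟩ := hq hv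
    have h := Exec.ite_false p (fits hs hb) hv h1
    exact ⟨_, _, h, by omega, h3, h.frame, h5⟩
  · obtain ⟨t, s', h1, h2, h3, h4, h5⟩ := hp hv
    have h := Exec.ite_true q (fits hs hb) hv h1
    exact ⟨_, _, h, by omega, h3, h.frame, h5⟩

/-- The rule for loops that run a fixed number of times. `I j` is the state of affairs before the
iteration number `j`; everything that the body does not write is known to be as before the loop. -/
theorem forLoop {x b N : ℕ} (I : ℕ → Store → Prop) (hs : s.Bounded (B + 2)) (hN : s.reg b = N)
    (hx : x ∉ p.regs) (hb : b ∉ p.regs) (hxb : b ≠ x) (h0 : I 0 (s.setReg x 0))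
    (hstep : ∀ j < N, ∀ s', s'.Bounded (B + 2) → s'.reg x = j →
      (Program.forLoop x b p).Frame s s' → I j s' →
      Runs B d p s' T fun s'' => I (j + 1) (s''.setReg x (j + 1))) :
    Runs B d (Program.forLoop x b p) s (N * (T + 8) + 6) (I N) := by
  have hN' : N < B + 2 := hN ▸ hs.1 b
  have hfr : ∀ {s'}, (Program.forLoop x b p).Frame s s' → s'.reg b = N := fun h => by
    rw [h.1 b (by simp [Program.forLoop, regs, hb, hxb]), hN]
  have main : ∀ k j, j + k = N → ∀ s', s'.Bounded (B + 2) → s'.reg x = j →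
      (Program.forLoop x b p).Frame s s' → I j s' →
      Runs B d (.while (.lt (.reg x) (.reg b)) (.seq p (.assign x (.add (.reg x) (.const 1)))))
        s' (k * (T + 8) + 4) (I N) := by
    intro k
    induction k with
    | zero =>
      intro j hj s' hs' hxj hF hI
      have h := Exec.while_false (W := (B + 2) ^ (d + 40)) (b := .lt (.reg x) (.reg b))
        (.seq p (.assign x (.add (.reg x) (.const 1)))) (s := s')
        (fits hs' (by simp [Expr.width])) (by simp [Expr.eval, hxj, hfr hF]; omega)
      refine ⟨_, _, h, by simp [Expr.cost], hs', .refl _ _, ?_⟩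
      rwa [show N = j by omega]
    | succ k ih =>
      intro j hj s' hs' hxj hF hI
      obtain ⟨t, s1, h1, h2, h3, h4, h5⟩ := hstep j (by omega) s' hs' hxj hF hI
      have hxs1 : s1.reg x = j := by rw [h4.1 x hx, hxj]
      have ha := Exec.assign (W := (B + 2) ^ (d + 40)) s1 x (.add (.reg x) (.const 1))
        (fits h3 (by simp [Expr.width]))
      have hev : (Expr.add (.reg x) (.const 1)).eval s1 = j + 1 := by simp [Expr.eval, hxs1]
      rw [hev] at ha
      have hbody := Exec.seq h1 ha
      obtain ⟨t', s2, h1', h2', h3', h4', h5'⟩ := ih (j + 1) (by omega) _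
        (h3.setReg (by omega)) (by simp)
        (hF.trans (hbody.frame.mono (by simp [Program.forLoop, regs])
          (by simp [Program.forLoop, arrs]))) h5
      have h := Exec.while_true (b := .lt (.reg x) (.reg b)) (fits hs' (by simp [Expr.width]))
        (by simp [Expr.eval, hxj, hfr hF]; omega) hbody h1'
      refine ⟨_, _, h, ?_, h3', h.frame, h5'⟩
      simp only [Expr.cost, Nat.succ_mul] at *
      omega
  unfold Program.forLoop
  refine (assign_seq (T := N * (T + 8) + 4) hs (by simp [Expr.width]) (by simp [Expr.eval])
    fun hs' => main N 0 (by omega) _ hs' (by simp [Expr.eval]) ?_ (by simpa [Expr.eval] using h0)).le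
    (by simp [Expr.cost]; omega)
  refine ⟨fun y hy => ?_, fun _ _ => rfl⟩
  have : y ≠ x := by rintro rfl; simp [Program.forLoop, regs] at hy
  simp [this]

end Runs

/-- The running time of a loop, for a body that takes at most `c * Y` steps. -/
theorem forLoop_cost {N T X Y c : ℕ} (hN : N ≤ X) (hT : T ≤ c * Y) (hX : 0 < X) (hY : 0 < Y) :
    N * (T + 8) + 6 ≤ (c + 14) * (X * Y) := by
  have h1 : N * (T + 8) ≤ X * (c * Y + 8 * Y) := Nat.mul_le_mul hN (by omega)
  have h2 : 0 < X * Y := Nat.mul_pos hX hY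
  calc N * (T + 8) + 6 ≤ X * (c * Y + 8 * Y) + 6 * (X * Y) := by omega
    _ = (c + 14) * (X * Y) := by ring

/-! ### The program -/

/-! Registers: the input `n`, `m`, `k`; the ends `rX`, `rP` and `rY`, `rZ` of the axis under
consideration; the candidate `rW` for the next label; the voter `rI`; the size `rPrev` of the axis
looked up; the value `rVal` and the next label `rNext` of the current entry; the largest value
`rBest` and the ends `rBX`, `rBP`, `rBY`, `rBZ` of an axis of this size; the number `rLim` of steps
of the reconstruction. -/

local notation "rN" => (0 : ℕ)
local notation "rM" => (1 : ℕ)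
local notation "rK" => (2 : ℕ)
local notation "rX" => (3 : ℕ)
local notation "rP" => (4 : ℕ)
local notation "rY" => (5 : ℕ)
local notation "rZ" => (6 : ℕ)
local notation "rW" => (7 : ℕ)
local notation "rI" => (8 : ℕ)
local notation "rPrev" => (9 : ℕ)
local notation "rVal" => (10 : ℕ)
local notation "rNext" => (11 : ℕ)
local notation "rBest" => (12 : ℕ)
local notation "rBX" => (13 : ℕ)
local notation "rBP" => (14 : ℕ)
local notation "rBY" => (15 : ℕ)
local notation "rBZ" => (16 : ℕ)
local notation "rLim" => (17 : ℕ)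

/-! Arrays: the votes, the output, the ranks, and the two components of `longest`. -/

local notation "aVotes" => (0 : ℕ)
local notation "aOut" => (1 : ℕ)
local notation "aRank" => (2 : ℕ)
local notation "aVal" => (3 : ℕ)
local notation "aNext" => (4 : ℕ)

/-- The entry `i, j` of a matrix with `m` columns, stored row by row. -/
def cellExpr (i j : Expr) : Expr := .add (.mul i (.reg rM)) j

/-- The cell of a table entry with four indices. -/
def addrExpr (x p y z : ℕ) : Expr :=
  cellExpr (cellExpr (cellExpr (.reg x) (.reg p)) (.reg y)) (.reg z)

/-- The rank in vote `rI` of the candidate labelled by the content of register `x`. -/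
def rankExpr (x : ℕ) : Expr := .load aRank (cellExpr (.reg rI) (.load aVotes (.reg x)))

/-- Invert all the votes. -/
def rankProg : Program :=
  forLoop rI rN (forLoop rW rM
    (.store aRank (cellExpr (.reg rI) (.load aVotes (cellExpr (.reg rI) (.reg rW)))) (.reg rW)))

/-- Set register `rPrev` to `0` if some voter ranks `rP` below both `rX` and `rW`. -/
def testProg : Program :=
  forLoop rI rN (.ite (.mul (.lt (rankExpr rX) (rankExpr rP)) (.lt (rankExpr rW) (rankExpr rP)))
    (.assign rPrev (.const 0)) .skip)

/-- Take `rW` into account for the table entry `rX, rP, rY, rZ`. -/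
def scanBody : Program :=
  .seq (.ite (.lt (.reg rY) (.reg rP))
      (.assign rPrev (.load aVal (addrExpr rP rW rY rZ)))
      (.assign rPrev (.load aVal (addrExpr rY rZ rP rW))))
    (.seq testProg
      (.ite (.mul (.lt (.const 0) (.reg rPrev)) (.lt (.reg rVal) (.add (.reg rPrev) (.const 1))))
        (.seq (.assign rVal (.add (.reg rPrev) (.const 1))) (.assign rNext (.reg rW)))
        .skip))

/-- Compute a table entry. -/
def scanProg : Program :=
  .seq (.assign rVal (.mul (.const 2) (.mul (.eq (.reg rP) (.reg rY)) (.eq (.reg rZ) (.reg rX)))))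
    (.seq (.assign rNext (.const 0)) (forLoop rW rM scanBody))

/-- Compute and store a table entry, and update the largest value found. -/
def entryProg : Program :=
  .ite (.mul (.lt (.reg rP) (.reg rX)) (.lt (.reg rY) (.reg rX)))
    (.seq scanProg
      (.seq (.store aVal (addrExpr rX rP rY rZ) (.reg rVal))
        (.seq (.store aNext (addrExpr rX rP rY rZ) (.reg rNext))
          (.ite (.lt (.reg rBest) (.reg rVal))
            (.seq (.assign rBest (.reg rVal))
              (.seq (.assign rBX (.reg rX))
                (.seq (.assign rBP (.reg rP))
                  (.seq (.assign rBY (.reg rY)) (.assign rBZ (.reg rZ))))))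
            .skip))))
    .skip

/-- Compute the whole table. -/
def tableProg : Program :=
  .seq (.assign rBest (.const 1))
    (forLoop rX rM (forLoop rP rM (forLoop rY rM (forLoop rZ rM entryProg))))

/-- Put the candidate with the label in register `x` into the output. -/
def markProg (x : ℕ) : Program := .store aOut (.load aVotes (.reg x)) (.const 1)

/-- Mark the last label of the axis with the ends `rBX`, `rBP`, `rBY`, `rBZ` and remove it. -/
def traceBody : Program :=
  .seq (markProg rBX)
    (.seq (.assign rW (.load aNext (addrExpr rBX rBP rBY rBZ)))
      (.ite (.lt (.reg rBY) (.reg rBP))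
        (.seq (.assign rBX (.reg rBP)) (.assign rBP (.reg rW)))
        (.seq (.assign rBX (.reg rBY))
          (.seq (.assign rBY (.reg rBP))
            (.seq (.assign rBP (.reg rBZ)) (.assign rBZ (.reg rW)))))))

/-- Mark all the labels of an optimal axis. -/
def traceProg : Program :=
  .seq (.assign rLim (.sub (.reg rBest) (.const 2)))
    (.seq (forLoop rI rLim traceBody) (.seq (markProg rBX) (markProg rBY)))

/-- The algorithm for candidate deletion. -/
def deletionProg : Program :=
  .seq rankProg (.seq tableProg (.seq traceProg
    (.assign rN (.lt (.reg rM) (.add (.add (.reg rBest) (.reg rK)) (.const 1))))))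

/-! ### Verification of the program -/

theorem cell_lt {a b i j m : ℕ} (ha : a < i) (hb : b < m) : a * m + b < i * m + j := by
  have : (a + 1) * m ≤ i * m := Nat.mul_le_mul_right m ha
  rw [Nat.succ_mul] at this
  omega

theorem cell_inj {a b i j m : ℕ} (hb : b < m) (hj : j < m) (h : a * m + b = i * m + j) :
    a = i ∧ b = j := by
  rcases lt_trichotomy a i with h' | rfl | h'
  · have := cell_lt (j := j) h' hb; omega
  · omega
  · have := cell_lt (j := b) h' hj; omega

section

variable {B d n m : ℕ} {s : Store}

/-- After `rankProg` the table of ranks inverts the votes. -/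
theorem rankProg_runs (hs : s.Bounded (B + 2)) (hn : s.reg rN = n) (hm : s.reg rM = m)
    (hn0 : 0 < n) (hm0 : 0 < m)
    (hA : ∀ i < n, ∀ j < m, s.arr aVotes (i * m + j) < m)
    (hinj : ∀ i < n, ∀ j < m, ∀ j' < m,
      s.arr aVotes (i * m + j) = s.arr aVotes (i * m + j') → j = j') :
    Runs B d rankProg s (40 * (n * m)) fun s' =>
      ∀ i < n, ∀ j < m, s'.arr aRank (i * m + s.arr aVotes (i * m + j)) = j := by
  let I : ℕ → Store → Prop := fun e s' =>
    ∀ i < n, ∀ j < m, i * m + j < e → s'.arr aRank (i * m + s.arr aVotes (i * m + j)) = j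
  refine ((Runs.forLoop (fun i => I (i * m)) hs hn (by decide) (by decide) (by decide)
    (by simp [I]) fun i hi s1 hs1 hi1 hF1 hI1 => ?_).imp fun s' _ _ h => ?_).le
      (forLoop_cost (T := 26 * m) le_rfl le_rfl hn0 hm0)
  · refine ((Runs.forLoop (N := m) (T := 12) (fun j => I (i * m + j)) hs1
      (by rw [hF1.1 _ (by decide), hm]) (by decide) (by decide) (by decide)
      (by simpa [I] using hI1) fun j hj s2 hs2 hj2 hF2 hI2 => ?_).imp fun s' _ _ h => ?_).le ?_
    · have hr : s2.reg rI = i := by rw [hF2.1 _ (by decide), hi1]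
      have hm2 : s2.reg rM = m := by rw [hF2.1 _ (by decide), hF1.1 _ (by decide), hm]
      have ha : s2.arr aVotes = s.arr aVotes := by
        rw [hF2.2 _ (by decide), hF1.2 _ (by decide)]
      refine Runs.store hs2 (by decide) (by decide) (hs2.1 _) ?_
      intro i' hi' j' hj' hlt
      simp only [Store.setReg_arr, Store.setArr_arr, cellExpr, Expr.eval, hr, hm2, ha, hj2,
        true_and]
      split_ifs with he
      · obtain ⟨rfl, h⟩ := cell_inj (hA i' hi' j' hj') (hA i hi j hj) he
        exact (hinj i' hi' j' hj' j hj h).symm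
      · refine hI2 i' hi' j' hj' ?_
        have : i' * m + j' ≠ i * m + j := fun h => by
          obtain ⟨rfl, rfl⟩ := cell_inj hj' hj h
          exact he rfl
        omega
    · rw [Nat.succ_mul]
      simpa [I] using h
    · have : 1 ≤ m := hm0
      omega
  · intro i hi j hj
    exact h i hi j hj (by simpa using cell_lt (j := 0) hi hj)

/-- The context of the main part of the program: the registers `rN` and `rM` hold the size of the
election, and `A`, `R` are the votes and the table of ranks. -/
structure Ready (n m : ℕ) (A R : ℕ → ℕ) (s : Store) : Prop where
  regN : s.reg rN = n
  regM : s.reg rM = m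
  votes : s.arr aVotes = A
  ranks : s.arr aRank = R

/-- The rank of the label `a` in vote `i`. -/
def labelRank (m : ℕ) (A R : ℕ → ℕ) (i a : ℕ) : ℕ := R (i * m + A a)

/-- The cell of a table entry with four indices. -/
def addr (m x p y z : ℕ) : ℕ := ((x * m + p) * m + y) * m + z

variable {A R : ℕ → ℕ}

theorem Ready.frame {p : Program} {s' : Store} (h : Ready n m A R s) (hF : p.Frame s s')
    (hn : rN ∉ p.regs) (hm : rM ∉ p.regs) (hA : aVotes ∉ p.arrs) (hR : aRank ∉ p.arrs) :
    Ready n m A R s' :=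
  ⟨(hF.1 _ hn).trans h.regN, (hF.1 _ hm).trans h.regM, (hF.2 _ hA).trans h.votes,
    (hF.2 _ hR).trans h.ranks⟩

theorem Ready.eval_addr (h : Ready n m A R s) (x p y z : ℕ) :
    (addrExpr x p y z).eval s = addr m (s.reg x) (s.reg p) (s.reg y) (s.reg z) := by
  simp [addrExpr, cellExpr, Expr.eval, addr, h.regM]

theorem Ready.eval_rank (h : Ready n m A R s) (x : ℕ) :
    (rankExpr x).eval s = labelRank m A R (s.reg rI) (s.reg x) := by
  simp [rankExpr, cellExpr, Expr.eval, labelRank, h.regM, h.votes, h.ranks]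

/-- One look at every vote decides whether `rP` may stand between `rX` and `rW`. -/
theorem testProg_runs (hs : s.Bounded (B + 2)) (h : Ready n m A R s) (hn0 : 0 < n) :
    Runs B d testProg s (49 * n) fun s' => s'.reg rPrev =
      if MiddleOK n (labelRank m A R) (s.reg rX) (s.reg rP) (s.reg rW) then s.reg rPrev else 0 := by
  refine (Runs.forLoop (N := n) (T := 35) (fun j s' => s'.reg rPrev =
      if MiddleOK j (labelRank m A R) (s.reg rX) (s.reg rP) (s.reg rW) then s.reg rPrev else 0)
    hs h.regN (by decide) (by decide) (by decide) (by simp [MiddleOK])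
    fun j hj s1 hs1 hj1 hF1 hI => ?_).le (by omega)
  have h1 := h.frame hF1 (by decide) (by decide) (by decide) (by decide)
  have hX : s1.reg rX = s.reg rX := hF1.1 _ (by decide)
  have hP : s1.reg rP = s.reg rP := hF1.1 _ (by decide)
  have hW : s1.reg rW = s.reg rW := hF1.1 _ (by decide)
  have hsucc : MiddleOK (j + 1) (labelRank m A R) (s.reg rX) (s.reg rP) (s.reg rW) ↔
      MiddleOK j (labelRank m A R) (s.reg rX) (s.reg rP) (s.reg rW) ∧
        ¬ (labelRank m A R j (s.reg rX) < labelRank m A R j (s.reg rP) ∧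
          labelRank m A R j (s.reg rW) < labelRank m A R j (s.reg rP)) :=
    Nat.forall_lt_succ_right
  have hev : (Expr.mul (.lt (rankExpr rX) (rankExpr rP)) (.lt (rankExpr rW) (rankExpr rP))).eval s1
      ≠ 0 ↔ (labelRank m A R j (s.reg rX) < labelRank m A R j (s.reg rP) ∧
          labelRank m A R j (s.reg rW) < labelRank m A R j (s.reg rP)) := by
    simp [Expr.eval, h1.eval_rank, hX, hP, hW, hj1, and_comm]
  refine (Runs.ite hs1 (by decide)
    (fun hv => Runs.assign hs1 (by decide) (by simp [Expr.eval]) ?_)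
    (fun hv => Runs.skip hs1 ?_)).le (T' := 35) (by decide)
  · rw [hev] at hv
    simp only [Store.setReg_reg, hsucc]
    simp [hv, Expr.eval]
  · have hv' := mt hev.2 (not_not.2 hv)
    simp only [Store.setReg_reg, hsucc]
    simpa [hv'] using hI

/-- The value table in the store. -/
def valueTable (m : ℕ) (s : Store) (x p y z : ℕ) : ℕ := s.arr aVal (addr m x p y z)

/-- The body of the loop over `rW` is one step of `scan`. -/
theorem scanBody_runs (hs : s.Bounded (B + 2)) (h : Ready n m A R s) (hn0 : 0 < n)
    (hv : prevValue (valueTable m s) (s.reg rP) (s.reg rY) (s.reg rZ) (s.reg rW) + 1 < B + 2) :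
    Runs B d scanBody s (120 * n) fun s' => (s'.reg rVal, s'.reg rNext) =
      if MiddleOK n (labelRank m A R) (s.reg rX) (s.reg rP) (s.reg rW) ∧
          0 < prevValue (valueTable m s) (s.reg rP) (s.reg rY) (s.reg rZ) (s.reg rW) ∧
          s.reg rVal < prevValue (valueTable m s) (s.reg rP) (s.reg rY) (s.reg rZ) (s.reg rW) + 1
        then (prevValue (valueTable m s) (s.reg rP) (s.reg rY) (s.reg rZ) (s.reg rW) + 1, s.reg rW)
        else (s.reg rVal, s.reg rNext) := by
  set v := prevValue (valueTable m s) (s.reg rP) (s.reg rY) (s.reg rZ) (s.reg rW) with hvdef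
  have hlook : Runs B d (.ite (.lt (.reg rY) (.reg rP))
      (.assign rPrev (.load aVal (addrExpr rP rW rY rZ)))
      (.assign rPrev (.load aVal (addrExpr rY rZ rP rW)))) s 36 fun s' => s' = s.setReg rPrev v := by
    refine (Runs.ite hs (by decide)
      (fun hc => Runs.assign hs (by decide) (by exact hs.2 _ _) ?_)
      (fun hc => Runs.assign hs (by decide) (by exact hs.2 _ _) ?_)).le (by decide)
    · have hc' : s.reg rY < s.reg rP := by
        by_contra hlt
        simp [Expr.eval, hlt] at hc
      simp [hvdef, prevValue, hc', Expr.eval, h.eval_addr, valueTable]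
    · have hc' : ¬ s.reg rY < s.reg rP := fun hlt => by
        simp [Expr.eval, hlt] at hc
      simp [hvdef, prevValue, hc', Expr.eval, h.eval_addr, valueTable]
  refine (Runs.seq hlook fun s1 hs1 hF1 e1 => Runs.seq (T' := 20)
    (testProg_runs hs1 (h.frame hF1 (by decide) (by decide) (by decide) (by decide)) hn0)
    fun s2 hs2 hF2 h2 => ?_).le (by omega)
  subst e1
  simp only [Store.setReg_reg] at h2
  norm_num at h2
  have hval : s2.reg rVal = s.reg rVal := by rw [hF2.1 _ (by decide)]; simp
  have hnext : s2.reg rNext = s.reg rNext := by rw [hF2.1 _ (by decide)]; simp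
  have hw : s2.reg rW = s.reg rW := by rw [hF2.1 _ (by decide)]; simp
  have hev : (Expr.mul (.lt (.const 0) (.reg rPrev))
      (.lt (.reg rVal) (.add (.reg rPrev) (.const 1)))).eval s2 ≠ 0 ↔
      (MiddleOK n (labelRank m A R) (s.reg rX) (s.reg rP) (s.reg rW) ∧ 0 < v ∧
        s.reg rVal < v + 1) := by
    simp only [Expr.eval, h2, hval]
    by_cases hM : MiddleOK n (labelRank m A R) (s.reg rX) (s.reg rP) (s.reg rW) <;> simp [hM]
    omega
  refine (Runs.ite hs2 (by decide) (fun hc => Runs.assign_seq hs2 (by decide) ?_ fun hs3 =>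
    Runs.assign hs3 (by decide) (by exact hs3.1 _) ?_) (fun hc => Runs.skip hs2 ?_)).le (by decide)
  · rw [hev] at hc
    simp [Expr.eval, h2, hc.1]
    omega
  · rw [hev] at hc
    rw [if_pos hc]
    simp [Expr.eval, h2, hc.1, hw]
  · rw [if_neg (mt hev.2 (not_not.2 hc)), hval, hnext]

theorem scanProg_runs (hB : 0 < B) (hs : s.Bounded (B + 2)) (h : Ready n m A R s) (hn0 : 0 < n) (hm0 : 0 < m)
    (hv : ∀ w < m, prevValue (valueTable m s) (s.reg rP) (s.reg rY) (s.reg rZ) w < m) :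
    Runs B d scanProg s (160 * (n * m)) fun s' => (s'.reg rVal, s'.reg rNext) =
      scan (prevValue (valueTable m s) (s.reg rP) (s.reg rY) (s.reg rZ))
        (fun w => MiddleOK n (labelRank m A R) (s.reg rX) (s.reg rP) w)
        (if s.reg rP = s.reg rY ∧ s.reg rZ = s.reg rX then 2 else 0) m := by
  have hmB : m < B + 2 := h.regM ▸ hs.1 _
  refine (Runs.assign_seq hs (by decide) ?_ fun hs1 => Runs.assign_seq hs1 (by decide)
    (by simp [Expr.eval]) fun hs2 => (Runs.forLoop (N := m) (T := 120 * n) (fun j s' =>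
      (s'.reg rVal, s'.reg rNext) =
      scan (prevValue (valueTable m s) (s.reg rP) (s.reg rY) (s.reg rZ))
        (fun w => MiddleOK n (labelRank m A R) (s.reg rX) (s.reg rP) w)
        (if s.reg rP = s.reg rY ∧ s.reg rZ = s.reg rX then 2 else 0) j)
      hs2 (by simpa using h.regM) (by decide) (by decide) (by decide) ?_
      fun j hj s3 hs3 hj3 hF3 hI => ?_).le (T' := 134 * (m * n))
        (forLoop_cost (c := 120) le_rfl le_rfl hm0 hn0)).le ?_
  · simp only [Expr.eval]
    by_cases h1 : s.reg rP = s.reg rY <;> by_cases h2 : s.reg rZ = s.reg rX <;> simp [h1, h2, hB]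
  · simp only [scan, Store.setReg_reg, Expr.eval]
    by_cases h1 : s.reg rP = s.reg rY <;> by_cases h2 : s.reg rZ = s.reg rX <;> simp [h1, h2]
  · have hr : ∀ r ∈ [rX, rP, rY, rZ], s3.reg r = s.reg r := by
      intro r hr
      fin_cases hr <;> rw [hF3.1 _ (by decide)] <;> simp
    have hX := hr rX (by decide)
    have hP := hr rP (by decide)
    have hY := hr rY (by decide)
    have hZ := hr rZ (by decide)
    have hT : valueTable m s3 = valueTable m s := by
      unfold valueTable
      rw [hF3.2 _ (by decide)]
      rfl
    have h3 : Ready n m A R s3 := by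
      refine Ready.frame ?_ hF3 (by decide) (by decide) (by decide) (by decide)
      exact ⟨by simpa using h.regN, by simpa using h.regM, h.votes, h.ranks⟩
    refine (scanBody_runs hs3 h3 hn0 ?_).imp fun s4 _ _ h4 => ?_
    · rw [hT, hP, hY, hZ, hj3]
      have := hv j hj
      omega
    · rw [hT, hX, hP, hY, hZ, hj3, hI] at h4
      have hV : s3.reg rVal = (scan (prevValue (valueTable m s) (s.reg rP) (s.reg rY) (s.reg rZ))
        (fun w => MiddleOK n (labelRank m A R) (s.reg rX) (s.reg rP) w)
        (if s.reg rP = s.reg rY ∧ s.reg rZ = s.reg rX then 2 else 0) j).1 := by rw [← hI]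
      rw [hV] at h4
      simpa [scan] using h4
  · have : 1 ≤ n * m := Nat.mul_pos hn0 hm0
    rw [Nat.mul_comm m n]
    simp only [Expr.cost]
    omega

end

section

variable {B d n m : ℕ} {s : Store} {A R : ℕ → ℕ} {q : ℕ → ℕ → ℕ}

/-- The table entry in cell `e`. -/
def entry (n m : ℕ) (q : ℕ → ℕ → ℕ) (e : ℕ) : ℕ × ℕ :=
  longest n m q (e / m / m / m) (e / m / m % m) (e / m % m) (e % m)

theorem entry_addr {p y z : ℕ} (x : ℕ) (hp : p < m) (hy : y < m) (hz : z < m) :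
    entry n m q (addr m x p y z) = longest n m q x p y z := by
  have hm : 0 < m := by omega
  have hdiv : ∀ a b, b < m → (a * m + b) / m = a := fun a b hb => by
    rw [Nat.add_comm, Nat.add_mul_div_right _ _ hm, Nat.div_eq_of_lt hb, zero_add]
  have hmod : ∀ a b, b < m → (a * m + b) % m = b := fun a b hb => by
    rw [Nat.mul_add_mod', Nat.mod_eq_of_lt hb]
  unfold entry addr
  rw [hdiv _ z hz, hmod _ z hz, hdiv _ y hy, hmod _ y hy, hdiv _ p hp, hmod _ p hp]

theorem addr_lt {x p y z x' p' y' z' : ℕ} (hx : x < x') (hp : p < m) (hy : y < m) (hz : z < m) :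
    addr m x p y z < addr m x' p' y' z' :=
  cell_lt (cell_lt (cell_lt hx hp) hy) hz

/-- The first `E` table entries have been computed, and the largest value found is in `rBest`,
together with a place where it occurs. -/
structure TableInv (n m : ℕ) (q : ℕ → ℕ → ℕ) (E : ℕ) (s : Store) : Prop where
  val : ∀ e, s.arr aVal e = if e < E then (entry n m q e).1 else 0
  next : ∀ e, s.arr aNext e = if e < E then (entry n m q e).2 else 0
  le_best : ∀ e < E, (entry n m q e).1 ≤ s.reg rBest
  best : (s.reg rBest = 1 ∧ s.reg rBX = 0 ∧ s.reg rBY = 0) ∨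
    (2 ≤ s.reg rBest ∧ s.reg rBX < m ∧ s.reg rBP < m ∧ s.reg rBY < m ∧ s.reg rBZ < m ∧
      (longest n m q (s.reg rBX) (s.reg rBP) (s.reg rBY) (s.reg rBZ)).1 = s.reg rBest)

theorem TableInv.setReg {E r : ℕ} (h : TableInv n m q E s) (hr : r < rBest) (v : ℕ) :
    TableInv n m q E (s.setReg r v) := by
  have hne : ∀ r' : ℕ, rBest ≤ r' → (s.setReg r v).reg r' = s.reg r' := fun r' hr' => by
    rw [Store.setReg_reg, if_neg (by omega)]
  refine ⟨h.val, h.next, ?_, ?_⟩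
  · rw [hne _ le_rfl]
    exact h.le_best
  · rw [hne _ (by decide), hne _ (by decide), hne _ (by decide), hne _ (by decide),
      hne _ (by decide)]
    exact h.best

/-- Writing the next entry keeps the invariant. -/
theorem TableInv.succ {E : ℕ} {s' : Store} (h : TableInv n m q E s)
    (hval : ∀ e, s'.arr aVal e = if e = E then (entry n m q E).1 else s.arr aVal e)
    (hnext : ∀ e, s'.arr aNext e = if e = E then (entry n m q E).2 else s.arr aNext e)
    (hle : s.reg rBest ≤ s'.reg rBest) (hE : (entry n m q E).1 ≤ s'.reg rBest)
    (hbest : (s'.reg rBest = 1 ∧ s'.reg rBX = 0 ∧ s'.reg rBY = 0) ∨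
      (2 ≤ s'.reg rBest ∧ s'.reg rBX < m ∧ s'.reg rBP < m ∧ s'.reg rBY < m ∧ s'.reg rBZ < m ∧
      (longest n m q (s'.reg rBX) (s'.reg rBP) (s'.reg rBY) (s'.reg rBZ)).1 = s'.reg rBest)) :
    TableInv n m q (E + 1) s' := by
  refine ⟨fun e => ?_, fun e => ?_, fun e he => ?_, hbest⟩
  · rw [hval, h.val]
    rcases lt_trichotomy e E with he | rfl | he
    · rw [if_neg (by omega), if_pos he, if_pos (by omega)]
    · simp
    · rw [if_neg (by omega), if_neg (by omega), if_neg (by omega)]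
  · rw [hnext, h.next]
    rcases lt_trichotomy e E with he | rfl | he
    · rw [if_neg (by omega), if_pos he, if_pos (by omega)]
    · simp
    · rw [if_neg (by omega), if_neg (by omega), if_neg (by omega)]
  · rcases Nat.lt_succ_iff_lt_or_eq.1 he with he | rfl
    · exact (h.le_best e he).trans hle
    · exact hE

theorem entryProg_runs {x p y z : ℕ} (hB : 0 < B) (hs : s.Bounded (B + 2))
    (h : Ready n m A R s) (hn0 : 0 < n)
    (hX : s.reg rX = x) (hP : s.reg rP = p) (hY : s.reg rY = y) (hZ : s.reg rZ = z)
    (hx : x < m) (hp : p < m) (hy : y < m) (hz : z < m)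
    (hI : TableInv n m (labelRank m A R) (addr m x p y z) s) :
    Runs B d entryProg s (240 * (n * m))
      (TableInv n m (labelRank m A R) (addr m x p y z + 1)) := by
  have hm0 : 0 < m := by omega
  have hent := entry_addr (n := n) (q := labelRank m A R) x hp hy hz
  have hev : (Expr.mul (.lt (.reg rP) (.reg rX)) (.lt (.reg rY) (.reg rX))).eval s ≠ 0 ↔
      (p < x ∧ y < x) := by
    simp [Expr.eval, hX, hP, hY, and_comm]
  refine (Runs.ite hs (by decide) (fun hc => ?_) (fun hc => Runs.skip hs ?_)
    (T := 160 * (n * m) + 50)).le ?_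
  · rw [hev] at hc
    -- the entries looked up have a smaller first index
    have hprev : ∀ w < m, prevValue (valueTable m s) p y z w =
        prevValue (fun x p y z => (longest n m (labelRank m A R) x p y z).1) p y z w := by
      intro w hw
      unfold prevValue valueTable
      split_ifs
      · rw [hI.val, if_pos (addr_lt hc.1 hw hy hz), entry_addr p hw hy hz]
      · rw [hI.val, if_pos (addr_lt hc.2 hz hp hw), entry_addr y hz hp hw]
    have hsmall : ∀ w < m, prevValue (valueTable m s) p y z w < m := by
      intro w hw
      rw [hprev w hw]
      unfold prevValue
      split_ifs
      · dsimp only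
        have := longest_le (n := n) (m := m) (q := labelRank m A R) p w y z
        omega
      · dsimp only
        have := longest_le (n := n) (m := m) (q := labelRank m A R) y z p w
        omega
    refine (Runs.seq (scanProg_runs hB hs h hn0 hm0 (by rwa [hP, hY, hZ])) (T' := 50)
      fun s1 hs1 hF1 h1 => ?_)
    have hr : ∀ r ∈ [rM, rX, rP, rY, rZ, rBest, rBX, rBP, rBY, rBZ], s1.reg r = s.reg r := by
      intro r hr
      fin_cases hr <;> exact hF1.1 _ (by decide)
    have hM1 := (hr rM (by decide)).trans h.regM
    have hX1 := (hr rX (by decide)).trans hX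
    have hP1 := (hr rP (by decide)).trans hP
    have hY1 := (hr rY (by decide)).trans hY
    have hZ1 := (hr rZ (by decide)).trans hZ
    have hb := hr rBest (by decide)
    have hbX := hr rBX (by decide)
    have hbP := hr rBP (by decide)
    have hbY := hr rBY (by decide)
    have hbZ := hr rBZ (by decide)
    have hav : s1.arr aVal = s.arr aVal := hF1.2 _ (by decide)
    have han : s1.arr aNext = s.arr aNext := hF1.2 _ (by decide)
    rw [hX, hP, hY, hZ, scan_congr hprev, ← longest_eq hc, ← hent] at h1
    have hval : s1.reg rVal = (entry n m (labelRank m A R) (addr m x p y z)).1 := by rw [← h1]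
    have hnext : s1.reg rNext = (entry n m (labelRank m A R) (addr m x p y z)).2 := by rw [← h1]
    refine (Runs.store_seq hs1 (by decide) (by decide) (by exact hs1.1 _) fun hs2 =>
      Runs.store_seq hs2 (by decide) (by decide) (by exact hs2.1 _) fun hs3 =>
      Runs.ite hs3 (by decide) (fun hc3 =>
        Runs.assign_seq hs3 (by decide) (by exact hs3.1 _) fun hs4 =>
        Runs.assign_seq hs4 (by decide) (by exact hs4.1 _) fun hs5 =>
        Runs.assign_seq hs5 (by decide) (by exact hs5.1 _) fun hs6 =>
        Runs.assign_seq hs6 (by decide) (by exact hs6.1 _) fun hs7 =>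
        Runs.assign hs7 (by decide) (by exact hs7.1 _) ?_)
      (fun hc3 => Runs.skip hs3 ?_)).le (by decide)
    -- a new largest value is recorded, the old one is kept otherwise
    · have hlt : s.reg rBest < (entry n m (labelRank m A R) (addr m x p y z)).1 := by
        by_contra hlt
        simp [Expr.eval, hval, hb, hlt] at hc3
      have h1best : 1 ≤ s.reg rBest := by
        rcases hI.best with hI | hI <;> omega
      refine hI.succ ?_ ?_ ?_ ?_ ?_ <;>
        simp [Expr.eval, addrExpr, cellExpr, hM1, hX1, hP1, hY1, hZ1, hval, hnext, hav, han]
      · exact fun e => rfl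
      · exact fun e => rfl
      · exact hlt.le
      · refine .inr ⟨by omega, hx, hp, hy, hz, by rw [hent]⟩
    · have hlt : ¬ s.reg rBest < (entry n m (labelRank m A R) (addr m x p y z)).1 := by
        intro hlt
        simp [Expr.eval, hval, hb, hlt] at hc3
      refine hI.succ ?_ ?_ ?_ ?_ ?_ <;>
        simp [Expr.eval, addrExpr, cellExpr, hM1, hX1, hP1, hY1, hZ1, hval, hnext, hav, han, hb,
          hbX, hbP, hbY, hbZ]
      · exact fun e => rfl
      · exact fun e => rfl
      · exact not_lt.1 hlt
      · exact hI.best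
  -- entries that do not belong to an axis are not written and remain `0`
  · have hc' := mt hev.2 (not_not.2 hc)
    have hzero : entry n m (labelRank m A R) (addr m x p y z) = (0, 0) := by
      rw [hent, longest_eq_zero hc']
    refine hI.succ (fun e => ?_) (fun e => ?_) le_rfl (by simp [hzero]) hI.best
    · rw [hzero]
      split_ifs with he
      · rw [hI.val, if_neg (by omega)]
      · rfl
    · rw [hzero]
      split_ifs with he
      · rw [hI.next, if_neg (by omega)]
      · rfl
  · have : 1 ≤ n * m := Nat.mul_pos hn0 hm0
    simp only [Expr.cost]
    omega

/-- The end of a row is the beginning of the next one. -/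
theorem addr_end_of_row (x p y : ℕ) : addr m x p y m = addr m x p (y + 1) 0 ∧
    addr m x p m 0 = addr m x (p + 1) 0 0 ∧ addr m x m 0 0 = addr m (x + 1) 0 0 0 := by
  unfold addr
  refine ⟨?_, ?_, ?_⟩ <;> ring

theorem tableProg_runs (hB : 0 < B) (hs : s.Bounded (B + 2)) (h : Ready n m A R s)
    (hn0 : 0 < n) (hm0 : 0 < m) (hval : ∀ e, s.arr aVal e = 0) (hnext : ∀ e, s.arr aNext e = 0)
    (hbX : s.reg rBX = 0) (hbY : s.reg rBY = 0) :
    Runs B d tableProg s (300 * (n * m ^ 5))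
      (TableInv n m (labelRank m A R) (addr m m 0 0 0)) := by
  set q := labelRank m A R
  have hnm : 0 < n * m := Nat.mul_pos hn0 hm0
  refine (Runs.assign_seq hs (by decide) (by simp [Expr.eval]) fun hs1 => Runs.le ?_
    (forLoop_cost le_rfl (forLoop_cost le_rfl (forLoop_cost le_rfl (forLoop_cost (c := 240)
    le_rfl le_rfl hm0 hnm) hm0 (Nat.mul_pos hm0 hnm)) hm0 (Nat.mul_pos hm0 (Nat.mul_pos hm0 hnm)))
    hm0 (Nat.mul_pos hm0 (Nat.mul_pos hm0 (Nat.mul_pos hm0 hnm))))).le ?_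
  · have h1 : Ready n m A R (s.setReg rBest ((Expr.const 1).eval s)) :=
      ⟨by simpa using h.regN, by simpa using h.regM, h.votes, h.ranks⟩
    have hI1 : TableInv n m q 0 (s.setReg rBest ((Expr.const 1).eval s)) := by
      refine ⟨fun e => ?_, fun e => ?_, fun e he => absurd he (Nat.not_lt_zero _), .inl ?_⟩
      · simpa using hval e
      · simpa using hnext e
      · simp [Expr.eval, hbX, hbY]
    refine Runs.forLoop (fun x => TableInv n m q (addr m x 0 0 0)) hs1 h1.regM (by decide)
      (by decide) (by decide) (by simpa [addr] using hI1.setReg (by decide) 0)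
      fun x hx s2 hs2 hX2 hF2 hI2 => ?_
    have h2 := h1.frame hF2 (by decide) (by decide) (by decide) (by decide)
    refine (Runs.forLoop (fun p => TableInv n m q (addr m x p 0 0)) hs2 h2.regM (by decide)
      (by decide) (by decide) (hI2.setReg (by decide) 0)
      fun p hp s3 hs3 hP3 hF3 hI3 => ?_).imp fun s' _ _ hI => ?_
    swap
    · rw [← (addr_end_of_row x 0 0).2.2]
      exact hI.setReg (by decide) _
    have h3 := h2.frame hF3 (by decide) (by decide) (by decide) (by decide)
    have hX3 := (hF3.1 rX (by decide)).trans hX2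
    refine (Runs.forLoop (fun y => TableInv n m q (addr m x p y 0)) hs3 h3.regM (by decide)
      (by decide) (by decide) (hI3.setReg (by decide) 0)
      fun y hy s4 hs4 hY4 hF4 hI4 => ?_).imp fun s' _ _ hI => ?_
    swap
    · rw [← (addr_end_of_row x p 0).2.1]
      exact hI.setReg (by decide) _
    have h4 := h3.frame hF4 (by decide) (by decide) (by decide) (by decide)
    have hX4 := (hF4.1 rX (by decide)).trans hX3
    have hP4 := (hF4.1 rP (by decide)).trans hP3
    refine (Runs.forLoop (fun z => TableInv n m q (addr m x p y z)) hs4 h4.regM (by decide)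
      (by decide) (by decide) (hI4.setReg (by decide) 0)
      fun z hz s5 hs5 hZ5 hF5 hI5 => ?_).imp fun s' _ _ hI => ?_
    swap
    · rw [← (addr_end_of_row x p y).1]
      exact hI.setReg (by decide) _
    have h5 := h4.frame hF5 (by decide) (by decide) (by decide) (by decide)
    have hX5 := (hF5.1 rX (by decide)).trans hX4
    have hP5 := (hF5.1 rP (by decide)).trans hP4
    have hY5 := (hF5.1 rY (by decide)).trans hY4
    exact (entryProg_runs hB hs5 h5 hn0 hX5 hP5 hY5 hZ5 hx hp hy hz hI5).imp
      fun s' _ _ hI => hI.setReg (by decide) _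
  · have h5 : m * (m * (m * (m * (n * m)))) = n * m ^ 5 := by ring
    have h6 : 1 ≤ n * m ^ 5 := Nat.mul_pos hn0 (pow_pos hm0 5)
    simp only [Expr.cost, h5]
    omega

end

section

variable {B d n m : ℕ} {s : Store} {A : ℕ → ℕ} {q : ℕ → ℕ → ℕ}

/-- The output consists of the candidates with labels in `M`. -/
def Marked (A : ℕ → ℕ) (M : Finset ℕ) (s : Store) : Prop :=
  ∀ c, s.arr aOut c = 1 ↔ ∃ a ∈ M, A a = c

theorem Marked.insert {M : Finset ℕ} {s' : Store} {x : ℕ} (h : Marked A M s)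
    (hs' : ∀ c, s'.arr aOut c = if c = A x then 1 else s.arr aOut c) :
    Marked A (insert x M) s' := by
  intro c
  rw [hs', Finset.exists_mem_insert]
  split_ifs with hc
  · simp [hc]
  · rw [h c]
    simp [Ne.symm hc]

/-- After some steps of the reconstruction of an axis of size `best` with ends `X, P` and `Y, Z`:
the labels in `M` have been marked and removed, and any axis with the ends that are left, which are
in the registers, can be completed by `M` to one with the original ends. If `best = 1` there is no
such axis, and the registers are `0`. -/
def TraceInv (n m : ℕ) (q : ℕ → ℕ → ℕ) (A : ℕ → ℕ) (best X P Y Z j : ℕ) (s : Store) : Prop :=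
  ∃ M : Finset ℕ, Marked A M s ∧
    ((best = 1 ∧ M = ∅ ∧ s.reg rBX = 0 ∧ s.reg rBY = 0) ∨
      (2 ≤ best ∧ s.reg rBX < m ∧ s.reg rBP < m ∧ s.reg rBY < m ∧ s.reg rBZ < m ∧
        (longest n m q (s.reg rBX) (s.reg rBP) (s.reg rBY) (s.reg rBZ)).1 + j = best ∧
        ∀ S v, Reach n m q (s.reg rBX) (s.reg rBP) (s.reg rBY) (s.reg rBZ) S v →
          Reach n m q X P Y Z (M ∪ S) (v + j)))

/-- One step of the reconstruction follows the recorded next label to a smaller axis. -/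
theorem traceBody_runs {best X P Y Z j : ℕ} (hs : s.Bounded (B + 2)) (hm : s.reg rM = m)
    (hA : s.arr aVotes = A)
    (hnext : ∀ x p y z, x < m → p < m → y < m → z < m →
      s.arr aNext (addr m x p y z) = (longest n m q x p y z).2)
    (hj : j < best - 2) (hI : TraceInv n m q A best X P Y Z j s) :
    Runs B d traceBody s 60 fun s' =>
      TraceInv n m q A best X P Y Z (j + 1) (s'.setReg rI (j + 1)) := by
  obtain ⟨M, hM, ⟨hb, -⟩ | ⟨hb, hx, hp, hy, hz, hv, hR⟩⟩ := hI
  · omega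
  set x := s.reg rBX with hxdef
  set p := s.reg rBP with hpdef
  set y := s.reg rBY with hydef
  set z := s.reg rBZ with hzdef
  obtain ⟨hw, hstep⟩ := longest_step hx (by omega) (w := s.arr aNext (addr m x p y z))
    (hnext x p y z hx hp hy hz).symm
  set w := s.arr aNext (addr m x p y z) with hwdef
  have hunion : ∀ S : Finset ℕ, insert x M ∪ S = M ∪ insert x S := fun S => by
    rw [Finset.insert_union, Finset.union_insert]
  refine (Runs.store_seq hs (by decide) (by decide) (by simp [Expr.eval]) fun hs1 =>
    Runs.assign_seq hs1 (by decide) (by exact hs1.2 _ _) fun hs2 =>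
    Runs.ite hs2 (by decide)
      (fun hc =>
        Runs.assign_seq hs2 (by decide) (by exact hs2.1 _) fun hs3 =>
        Runs.assign hs3 (by decide) (by exact hs3.1 _) ?_)
      (fun hc =>
        Runs.assign_seq hs2 (by decide) (by exact hs2.1 _) fun hs3 =>
        Runs.assign_seq hs3 (by decide) (by exact hs3.1 _) fun hs4 =>
        Runs.assign_seq hs4 (by decide) (by exact hs4.1 _) fun hs5 =>
        Runs.assign hs5 (by decide) (by exact hs5.1 _) ?_)).le (by decide)
  · have hlt : y < p := by
      by_contra hlt
      simp [Expr.eval, ← hpdef, ← hydef, hlt] at hc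
    rw [if_pos hlt] at hstep
    refine ⟨insert x M, hM.insert ?_, .inr ?_⟩
    · simp [Expr.eval, hA, ← hxdef]
    · simp only [Expr.eval, addrExpr, cellExpr, Store.setReg_reg,
        Store.setArr_reg, Store.setArr_arr, hm, ← hxdef, ← hpdef, ← hydef, ← hzdef]
      norm_num
      rw [show s.arr aNext (((x * m + p) * m + y) * m + z) = w from rfl]
      refine ⟨hb, hp, hw, hy, hz, by omega, fun S v hS => ?_⟩
      have := hR _ _ (hstep.2 S v hS)
      rw [← Finset.insert_union, hunion]
      rwa [show v + (j + 1) = v + 1 + j by omega]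
  · have hlt : ¬ y < p := by
      intro hlt
      simp [Expr.eval, ← hpdef, ← hydef, hlt] at hc
    rw [if_neg hlt] at hstep
    refine ⟨insert x M, hM.insert ?_, .inr ?_⟩
    · simp [Expr.eval, hA, ← hxdef]
    · simp only [Expr.eval, addrExpr, cellExpr, Store.setReg_reg,
        Store.setArr_reg, Store.setArr_arr, hm, ← hxdef, ← hpdef, ← hydef, ← hzdef]
      norm_num
      rw [show s.arr aNext (((x * m + p) * m + y) * m + z) = w from rfl]
      refine ⟨hb, hy, hz, hp, hw, by omega, fun S v hS => ?_⟩
      have := hR _ _ (hstep.2 S v hS)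
      rw [← Finset.insert_union, hunion]
      rwa [show v + (j + 1) = v + 1 + j by omega]

/-- The labels of an axis of the largest size are marked. For `m = 1` there are no ends, and the
only label `0` is marked because the registers are still `0`. -/
theorem traceProg_runs (hs : s.Bounded (B + 2)) (hm : s.reg rM = m) (hm0 : 0 < m)
    (hA : s.arr aVotes = A)
    (hout : ∀ c, s.arr aOut c = 0) (hI : TableInv n m q (addr m m 0 0 0) s) :
    Runs B d traceProg s (100 * m) fun s' => ∃ M, Marked A M s' ∧
      ((s.reg rBest = 1 ∧ M = {0}) ∨ ∃ x p y z, Reach n m q x p y z M (s.reg rBest)) := by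
  have hnext : ∀ x p y z, x < m → p < m → y < m → z < m →
      s.arr aNext (addr m x p y z) = (longest n m q x p y z).2 := by
    intro x p y z hx hp hy hz
    rw [hI.next, if_pos (addr_lt hx hp hy hz), entry_addr x hp hy hz]
  have hbest : s.reg rBest ≤ m := by
    rcases hI.best with ⟨h, -⟩ | ⟨-, h, -, -, -, h'⟩
    · omega
    · have := longest_le (n := n) (m := m) (q := q) (s.reg rBX) (s.reg rBP) (s.reg rBY)
        (s.reg rBZ)
      omega
  have hmB : m < B + 2 := hm ▸ hs.1 _
  refine (Runs.assign_seq hs (by decide) (by simp [Expr.eval]; omega) fun hs1 =>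
    Runs.seq (T' := 20) (Runs.forLoop (N := s.reg rBest - 2) (T := 60)
      (fun j => TraceInv n m q A (s.reg rBest) (s.reg rBX) (s.reg rBP) (s.reg rBY)
        (s.reg rBZ) j) hs1 (by simp [Expr.eval]) (by decide) (by decide) (by decide) ?_
      fun j hj s2 hs2 hj2 hF2 hI2 => ?_) fun s3 hs3 hF3 hI3 => ?_).le ?_
  · refine ⟨∅, fun c => ?_, ?_⟩
    · simp [hout]
    · rcases hI.best with ⟨h1, h2, h3⟩ | ⟨h1, h2, h3, h4, h5, h6⟩
      · exact .inl ⟨h1, rfl, by simpa using h2, by simpa using h3⟩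
      · exact .inr ⟨h1, by simpa using h2, by simpa using h3, by simpa using h4,
          by simpa using h5, by simpa using h6, fun S v hS => by simpa using hS⟩
  · refine traceBody_runs hs2 ?_ ?_ ?_ hj hI2
    · rw [hF2.1 _ (by decide)]
      simpa using hm
    · rw [hF2.2 _ (by decide)]
      exact hA
    · rw [hF2.2 _ (by decide)]
      exact hnext
  · have hA3 : s3.arr aVotes = A := by
      rw [hF3.2 _ (by decide)]
      exact hA
    obtain ⟨M, hM, hM'⟩ := hI3
    refine (Runs.store_seq hs3 (by decide) (by decide) (by simp [Expr.eval]) fun hs4 =>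
      Runs.store hs4 (by decide) (by decide) (by simp [Expr.eval])
        ⟨insert (s3.reg rBY) (insert (s3.reg rBX) M),
          (hM.insert (s' := s3.setArr aOut (s3.arr aVotes (s3.reg rBX)) 1) ?_).insert ?_,
          ?_⟩).le (by decide)
    · simp [hA3]
    · simp [Expr.eval, hA3]
    · rcases hM' with ⟨h1, rfl, h2, h3⟩ | ⟨h1, h2, h3, h4, h5, h6, h7⟩
      · exact .inl ⟨h1, by simp [h2, h3]⟩
      · -- two labels are left
        have h8 := h7 _ _ (reach_of_longest_eq_two h2 (by omega))
        refine .inr ⟨s.reg rBX, s.reg rBP, s.reg rBY, s.reg rBZ, ?_⟩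
        rw [show s.reg rBest = 2 + (s.reg rBest - 2) by omega]
        convert h8 using 1
        ext a
        simp only [Finset.mem_insert, Finset.mem_union, Finset.mem_singleton]
        tauto
  · simp only [Expr.cost]
    omega

end

/-! ### Correctness of the algorithm -/

section

variable {n m : ℕ} (votes : Fin n → Equiv.Perm (Fin m)) (k : ℕ)

theorem inputStore_bounded : (inputStore votes k).Bounded (n + m + k + 2) := by
  refine ⟨fun x => ?_, fun a z => ?_⟩
  · simp only [inputStore]
    split_ifs <;> omega
  · simp only [inputStore]
    split_ifs with h
    · have := (votes ⟨z / m, h.2.1⟩ ⟨z % m, h.2.2⟩).is_lt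
      omega
    · omega

theorem inputStore_votes {i j : ℕ} (hi : i < n) (hj : j < m) :
    (inputStore votes k).arr aVotes (i * m + j) = votes ⟨i, hi⟩ ⟨j, hj⟩ := by
  have hdiv : (i * m + j) / m = i := by
    rw [Nat.add_comm, Nat.add_mul_div_right _ _ (by omega), Nat.div_eq_of_lt hj, zero_add]
  have hmod : (i * m + j) % m = j := by rw [Nat.mul_add_mod', Nat.mod_eq_of_lt hj]
  simp only [inputStore, hdiv, hmod]
  simp [hi, hj]

theorem inputStore_arr {a : ℕ} (ha : a ≠ 0) (z : ℕ) : (inputStore votes k).arr a z = 0 := by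
  simp [inputStore, ha]

variable {votes}

/-- The value and the marked labels found by the program describe a maximum consistent set. -/
theorem isMaximum_of_marked (hn : 0 < n) (hm : 0 < m) {q : ℕ → ℕ → ℕ} {A : ℕ → ℕ}
    (hq : ∀ (i : Fin n) (c : Fin m), q i (label votes hn c) = (votes i).symm c)
    (hA : ∀ c : Fin m, A (label votes hn c) = c) {s : Store} {M : Finset ℕ} {best : ℕ}
    (hM : Marked A M s) (hbest : 1 ≤ best)
    (hR : (best = 1 ∧ M = {0}) ∨ ∃ x p y z, Reach n m q x p y z M best)
    (hle : ∀ x p y z, x < m → p < m → y < m → z < m → (longest n m q x p y z).1 ≤ best) :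
    (profileOf votes).IsMaximumSinglePeakedSubset (outputSet m s) ∧
      (outputSet m s).card = best := by
  have hMm : ∀ a ∈ M, a < m := by
    rcases hR with ⟨-, rfl⟩ | ⟨x, p, y, z, hR⟩
    · simpa using hm
    · exact hR.lt_of_mem
  have himage : (outputSet m s).image (label votes hn) = M := by
    ext a
    simp only [Finset.mem_image, outputSet, Finset.mem_filter, Finset.mem_univ, true_and]
    constructor
    · rintro ⟨c, hc, rfl⟩
      obtain ⟨a, ha, hac⟩ := (hM c).1 hc
      obtain ⟨c', rfl⟩ := exists_label votes hn (hMm a ha)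
      rw [hA] at hac
      rwa [← Fin.ext hac]
    · intro ha
      obtain ⟨c, rfl⟩ := exists_label votes hn (hMm a ha)
      exact ⟨c, (hM c).2 ⟨_, ha, hA c⟩, rfl⟩
  have hcard := Finset.card_image_of_injective (outputSet m s) (label_injective votes hn)
  rw [himage] at hcard
  have hMcard : M.card = best := by
    rcases hR with ⟨rfl, rfl⟩ | ⟨x, p, y, z, hR⟩
    · rfl
    · exact hR.card_eq
  refine ⟨⟨?_, fun T hT => ?_⟩, by omega⟩
  · rcases hR with ⟨-, rfl⟩ | ⟨x, p, y, z, hR⟩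
    · obtain ⟨c, hc⟩ := Finset.card_eq_one.1 (hcard.symm.trans (by simp))
      rw [hc]
      exact singlePeakedConsistent_singleton hq c
    · exact Reach.singlePeakedConsistent hq (by rwa [himage])
  · by_cases hT2 : 2 ≤ T.card
    · obtain ⟨x, p, y, z, S, hS⟩ := exists_reach_of_singlePeakedConsistent hq hT2 hT
      have hl := hS.lt
      have := hle x p y z hl.2.2.1 (by omega) (by omega) hl.2.2.2
      have := hS.le_longest
      omega
    · omega

theorem deletionProg_runs (hn : 0 < n) (hm : 0 < m) (d : ℕ) :
    Runs (n + m + k) d deletionProg (inputStore votes k) (500 * (n * m ^ 5)) fun s =>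
      ((profileOf votes).CandidateDeletionConsistent k → s.reg 0 = 1) ∧
        (¬ (profileOf votes).CandidateDeletionConsistent k → s.reg 0 = 0) ∧
        (profileOf votes).IsMaximumSinglePeakedSubset (outputSet m s) := by
  set A := (inputStore votes k).arr aVotes with hAdef
  have hAv : ∀ {i j : ℕ} (hi : i < n) (hj : j < m), A (i * m + j) = votes ⟨i, hi⟩ ⟨j, hj⟩ :=
    fun hi hj => inputStore_votes votes k hi hj
  have hA : ∀ c : Fin m, A (label votes hn c) = c := by
    intro c
    have := hAv hn (label_lt votes hn c)
    rw [zero_mul, zero_add] at this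
    rw [this]
    simp [label]
  have hB0 := inputStore_bounded votes k
  have hregN : (inputStore votes k).reg rN = n := rfl
  have hregM : (inputStore votes k).reg rM = m := rfl
  have hregK : (inputStore votes k).reg rK = k := rfl
  refine (Runs.seq (T' := 300 * (n * m ^ 5) + (100 * m + 10))
    (rankProg_runs hB0 hregN hregM hn hm ?_ ?_) fun s1 hs1 hF1 hR => ?_).le ?_
  · intro i hi j hj
    rw [← hAdef, hAv hi hj]
    exact Fin.is_lt _
  · intro i hi j hj j' hj' h
    rw [← hAdef, hAv hi hj, hAv hi hj'] at h
    simpa using (votes ⟨i, hi⟩).injective (Fin.ext h)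
  · rw [← hAdef] at hR
    have h1 : Ready n m A (s1.arr aRank) s1 :=
      ⟨hF1.1 _ (by decide), hF1.1 _ (by decide), hF1.2 _ (by decide), rfl⟩
    have hzero : ∀ a ∈ [aOut, aVal, aNext], ∀ z, s1.arr a z = 0 := by
      intro a ha z
      fin_cases ha <;> rw [hF1.2 _ (by decide)] <;> exact inputStore_arr votes k (by decide) z
    have hq : ∀ (i : Fin n) (c : Fin m),
        labelRank m A (s1.arr aRank) i (label votes hn c) = (votes i).symm c := by
      intro i c
      have := hR i i.2 ((votes i).symm c) (Fin.is_lt _)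
      rw [hAv i.2 (Fin.is_lt _)] at this
      simpa [labelRank, hA] using this
    refine Runs.seq (tableProg_runs (by omega) hs1 h1 hn hm (hzero aVal (by decide))
      (hzero aNext (by decide)) (hF1.1 _ (by decide)) (hF1.1 _ (by decide)))
      fun s2 hs2 hF2 hI => ?_
    have h2 := h1.frame hF2 (by decide) (by decide) (by decide) (by decide)
    refine Runs.seq (traceProg_runs hs2 h2.regM hm h2.votes ?_ hI) fun s3 hs3 hF3 hM => ?_
    · rw [hF2.2 _ (by decide)]
      exact hzero aOut (by decide)
    · obtain ⟨M, hM, hMR⟩ := hM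
      have hbest : 1 ≤ s2.reg rBest := by
        rcases hI.best with h | h <;> omega
      have hle : ∀ x p y z, x < m → p < m → y < m → z < m →
          (longest n m (labelRank m A (s1.arr aRank)) x p y z).1 ≤ s2.reg rBest := by
        intro x p y z hx hp hy hz
        rw [← entry_addr x hp hy hz]
        exact hI.le_best _ (addr_lt hx hp hy hz)
      obtain ⟨hmax, hcard⟩ := isMaximum_of_marked hn hm hq hA hM hbest hMR hle
      have hb3 : s3.reg rBest = s2.reg rBest := hF3.1 _ (by decide)
      have hk3 : s3.reg rK = k := by
        rw [hF3.1 _ (by decide), hF2.1 _ (by decide), hF1.1 _ (by decide), hregK]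
      have hm3 : s3.reg rM = m := by rw [hF3.1 _ (by decide), h2.regM]
      refine (Runs.assign hs3 (by decide) ?_ ⟨fun h => ?_, fun h => ?_, hmax⟩).le (by decide)
      · by_cases hlt : s3.reg rM < s3.reg rBest + s3.reg rK + 1 <;> simp [Expr.eval, hlt]
      · rw [candidateDeletionConsistent_iff hmax, hcard] at h
        simp [Expr.eval, hb3, hk3, hm3]
        omega
      · rw [candidateDeletionConsistent_iff hmax, hcard] at h
        simp [Expr.eval, hb3, hk3, hm3]
        omega
  · have h1 : n * m ≤ n * m ^ 5 := Nat.mul_le_mul_left n (Nat.le_self_pow (by decide) m)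
    have h2 : m ≤ n * m := Nat.le_mul_of_pos_left m hn
    omega

end
end NearlySinglePeaked

theorem mainTheorem7 :
    ∃ (prog : NearlySinglePeaked.Program) (K : ℕ),
      ∀ (n m k : ℕ), 0 < n → 0 < m → ∀ votes : Fin n → Equiv.Perm (Fin m),
        ∃ (t : ℕ) (s : NearlySinglePeaked.Store),
          NearlySinglePeaked.Exec ((n + m + k + 2) ^ K) prog
              (NearlySinglePeaked.inputStore votes k) t s ∧
          t ≤ K * (n * m ^ 5) ∧
          ((NearlySinglePeaked.profileOf votes).CandidateDeletionConsistent k → s.reg 0 = 1) ∧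
          (¬ (NearlySinglePeaked.profileOf votes).CandidateDeletionConsistent k → s.reg 0 = 0) ∧
          (NearlySinglePeaked.profileOf votes).IsMaximumSinglePeakedSubset
            (NearlySinglePeaked.outputSet m s) := by
  -- the exponent `d + 40` of `Runs` serves as the constant `500` of the running time as well
  refine ⟨NearlySinglePeaked.deletionProg, 460 + 40, fun n m k hn hm votes => ?_⟩
  obtain ⟨t, s, hE, ht, -, -, h⟩ :=
    NearlySinglePeaked.deletionProg_runs (votes := votes) k hn hm 460
  exact ⟨t, s, hE, ht, h⟩
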